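/- Let $q>2$ be a prime power, let $K=\mathbb{F}_{q^2}$, and let $H=K(x,y)$, with $x$ transcendental over $K$ and $y^q+y=x^{q+1}$, be the Hermitian function field. Let $\mathrm{Aut}(H)$ be the group of field automorphisms of $H$ that fix $K$ pointwise, and let $\mathrm{Cl}^0(H)$ be the group of degree-zero divisors of $H$ modulo principal divisors. Then: (1) There is an injective group homomorphism $\phi:\mathrm{Aut}(H)\to\mathrm{Aut}(\mathrm{Cl}^0(H))$ given by the induced action on divisor classes, $$\phi(\sigma)\Big(\Big[\sum_P a_P P\Big]\Big)=\Big[\sum_P a_P\,\sigma(P)\Big]$$ for every degree-zero divisor $\sum_P a_P P$. In particular $\mathrm{Aut}(H)$ is isomorphic to a subgroup of $\mathrm{Aut}(\mathrm{Cl}^0(H))$. (2) Let $\mathcal{P}$ be the set of rational places (places of degree one) of $H$. If $f\in H$ is nonzero and non-constant (i.e. $f\notin K$) and the divisor of $f$ has support contained in $\mathcal{P}$, then $\deg f:=\sum_{P:\,v_P(f)>0}v_P(f)>2$. -/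

import Mathlib

/-- A Hermitian function field over `K` with parameter `q` (where `K` is the field with `q ^ 2`
elements): a field `H = K(x, y)` with `x` transcendental over `K` and `y ^ q + y = x ^ (q + 1)`. -/
def IsHermitianFunctionField (q : ℕ) (K H : Type*) [Field K] [Field H] [Algebra K H] : Prop :=
  ∃ x y : H, Transcendental K x ∧ y ^ q + y = x ^ (q + 1) ∧
    IntermediateField.adjoin K {x, y} = ⊤

/-- Hermitian function fields exist: the polynomial `x ^ (q + 1) - (y ^ q + y)` is irreducible, and
the fraction field of the quotient of `K[y][x]` by it is one. -/
theorem exists_isHermitianFunctionField.{u} {K : Type u} [Field K] (q : ℕ) (hq : 2 ≤ q) :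
    ∃ (H : Type u) (_ : Field H) (_ : Algebra K H), IsHermitianFunctionField q K H := by
  open Polynomial in
  let f : K[X][X] := X ^ (q + 1) - C (X ^ q + X)
  have hmonic : f.Monic := monic_X_pow_sub_C _ q.succ_ne_zero
  have hdeg : f.degree = ((q + 1 : ℕ) : WithBot ℕ) :=
    degree_X_pow_sub_C (Nat.succ_pos q) _
  have hP : (Ideal.span {(X : K[X])}).IsPrime :=
    (Ideal.span_singleton_prime X_ne_zero).2 prime_X
  have hirr : Irreducible f := by
    refine irreducible_of_eisenstein_criterion hP ?_ ?_ ?_ ?_ hmonic.isPrimitive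
    · rw [hmonic.leadingCoeff]
      exact (Ideal.ne_top_iff_one _).1 hP.ne_top
    · intro n hn
      rw [hdeg, Nat.cast_lt] at hn
      rcases Nat.eq_zero_or_pos n with rfl | hn0
      · have : f.coeff 0 = -(X ^ q + X) := by simp only [f, coeff_sub, coeff_X_pow, coeff_C]; simp
        rw [this, Ideal.mem_span_singleton, dvd_neg]
        exact dvd_add (dvd_pow_self _ (by omega)) dvd_rfl
      · have : f.coeff n = 0 := by
          simp only [f, coeff_sub, coeff_X_pow, coeff_C]; simp [hn.ne, hn0.ne']
        rw [this]
        exact Ideal.zero_mem _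
    · rw [hdeg]
      exact_mod_cast Nat.succ_pos q
    · have : f.coeff 0 = -(X ^ q + X) := by simp only [f, coeff_sub, coeff_X_pow, coeff_C]; simp
      rw [this, Ideal.span_singleton_pow, Ideal.mem_span_singleton, dvd_neg]
      intro h
      have h2 : (X : K[X]) ^ 2 ∣ X := (dvd_add_right (pow_dvd_pow _ hq)).1 h
      have := (X_pow_dvd_iff.1 h2) 1 (by norm_num)
      simp at this
  have hprime : Prime f := hirr.prime
  have : IsDomain (AdjoinRoot f) := AdjoinRoot.isDomain_of_prime hprime
  let A := AdjoinRoot f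
  let H := FractionRing A
  let x : H := algebraMap A H (AdjoinRoot.root f)
  let y : H := algebraMap A H (AdjoinRoot.of f X)
  have hxy : y ^ q + y = x ^ (q + 1) := by
    have h0 : AdjoinRoot.mk f f = 0 := AdjoinRoot.mk_self
    have h1 : (AdjoinRoot.root f) ^ (q + 1) - AdjoinRoot.of f (X ^ q + X) = 0 := by
      simpa [f] using h0
    have h2 := congrArg (algebraMap A H) (sub_eq_zero.1 h1)
    simp only [map_add, map_pow] at h2
    exact h2.symm
  have hy : Transcendental K y := by
    let ψ : K[X] →ₐ[K] H := (IsScalarTower.toAlgHom K A H).comp (IsScalarTower.toAlgHom K K[X] A)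
    have hψ : Function.Injective ψ := by
      refine (IsFractionRing.injective A H).comp ?_
      refine AdjoinRoot.of.injective_of_degree_ne_zero ?_
      rw [hdeg]
      exact_mod_cast q.succ_ne_zero
    exact fun h => transcendental_X K ((isAlgebraic_algHom_iff (a := (X : K[X])) ψ hψ).1 h)
  refine ⟨H, inferInstance, inferInstance, x, y, ?_, hxy, ?_⟩
  · have h1 : Transcendental K (y ^ q + y) := by
      have hd : (X ^ q + X : K[X]).natDegree = q := by
        rw [natDegree_add_eq_left_of_natDegree_lt] <;> simp; omega
      have h := hy.aeval_of_transcendental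
        (Polynomial.transcendental (X ^ q + X : K[X]) (by omega)
          (mem_nonZeroDivisors_of_ne_zero (leadingCoeff_ne_zero.2
            (ne_zero_of_natDegree_gt (n := 0) (by omega)))))
      rwa [map_add, map_pow, aeval_X] at h
    rw [hxy] at h1
    exact fun h => h1 (h.pow _)
  · rw [eq_top_iff]
    intro z _
    have hA : ∀ a : A, algebraMap A H a ∈ IntermediateField.adjoin K {x, y} := by
      have hx' : x ∈ IntermediateField.adjoin K {x, y} :=
        IntermediateField.subset_adjoin _ _ (by simp)
      have hy' : y ∈ IntermediateField.adjoin K {x, y} :=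
        IntermediateField.subset_adjoin _ _ (by simp)
      have hR : ∀ r : K[X], algebraMap A H (AdjoinRoot.of f r) ∈
          IntermediateField.adjoin K {x, y} := by
        intro r
        induction r using Polynomial.induction_on' with
        | add p s hp hs => simpa using add_mem hp hs
        | monomial n c =>
          rw [← C_mul_X_pow_eq_monomial, map_mul, map_mul, map_pow, map_pow]
          exact mul_mem ((IntermediateField.adjoin K {x, y}).algebraMap_mem c) (pow_mem hy' n)
      intro a
      induction a using AdjoinRoot.induction_on with
      | ih p =>
        induction p using Polynomial.induction_on' with
        | add p s hp hs => simpa using add_mem hp hs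
        | monomial n c =>
          rw [← C_mul_X_pow_eq_monomial, map_mul, map_mul, map_pow, map_pow]
          exact mul_mem (hR c) (pow_mem hx' n)
    obtain ⟨a, b, -, rfl⟩ := IsFractionRing.div_surjective (A := A) z
    exact div_mem (hA a) (hA b)

namespace FunctionFieldDivisor

/-- A place of `F / K`, given by its valuation ring, a proper valuation subring of `F`
that contains `K`. -/
@[ext]
structure Place (K F : Type*) [Field K] [Field F] [Algebra K F] where
  ring : ValuationSubring F
  algebraMap_mem : ∀ c : K, algebraMap K F c ∈ ring
  ne_top : ring ≠ ⊤

namespace Place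

variable {K F : Type*} [Field K] [Field F] [Algebra K F]

instance instAlgebraRing (P : Place K F) : Algebra K P.ring :=
  ((algebraMap K F).codRestrict P.ring.toSubring P.algebraMap_mem).toAlgebra

/-- The degree of a place: the dimension over `K` of its residue field. -/
noncomputable def degree (P : Place K F) : ℕ :=
  Module.finrank K (IsLocalRing.ResidueField P.ring)

/-- `P.IsOrd f n` says that `v_P(f) = n` for the normalized discrete valuation `v_P` of `P`:
`f` has the same value as `t ^ n`, that is `f = u * t ^ n` with `u` a unit of the valuation ring,
where `t` is a generator of the maximal ideal. -/
def IsOrd (P : Place K F) (f : F) (n : ℤ) : Prop :=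
  ∃ t : P.ring, IsLocalRing.maximalIdeal P.ring = Ideal.span {t} ∧
    P.ring.valuation f = P.ring.valuation (t : F) ^ n

/-- The image `σ(P)` of a place under an automorphism `σ` of `F / K`; its valuation ring
is `σ(O_P)`, that is the set of all `f` with `σ⁻¹(f)` in `O_P`. -/
def map (σ : F ≃ₐ[K] F) (P : Place K F) : Place K F where
  ring := P.ring.comap (σ.symm : F →+* F)
  algebraMap_mem c := by
    simpa [ValuationSubring.mem_comap] using P.algebraMap_mem c
  ne_top h := P.ne_top <| by
    refine top_unique fun f _ => ?_
    have hf : σ f ∈ P.ring.comap (σ.symm : F →+* F) := h ▸ ValuationSubring.mem_top _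
    simpa [ValuationSubring.mem_comap] using hf

theorem mem_map_ring (σ : F ≃ₐ[K] F) (P : Place K F) (f : F) :
    f ∈ (P.map σ).ring ↔ σ.symm f ∈ P.ring := Iff.rfl

/-- `σ` restricts to an isomorphism from the valuation ring of `P` to that of `σ(P)`. -/
def ringEquivMap (σ : F ≃ₐ[K] F) (P : Place K F) : P.ring ≃+* (P.map σ).ring where
  toFun f := ⟨σ f, by simp [mem_map_ring]⟩
  invFun f := ⟨σ.symm f, f.2⟩
  left_inv f := by simp
  right_inv f := by simp
  map_mul' f g := by ext; simp
  map_add' f g := by ext; simp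

theorem degree_map (σ : F ≃ₐ[K] F) (P : Place K F) : (P.map σ).degree = P.degree := by
  refine (Algebra.finrank_eq_of_equiv_equiv (RingEquiv.refl K)
    (IsLocalRing.ResidueField.mapEquiv (ringEquivMap σ P)) ?_).symm
  ext c
  change IsLocalRing.residue _ (algebraMap K (P.map σ).ring c) =
    IsLocalRing.residue _ (ringEquivMap σ P (algebraMap K P.ring c))
  congr 1
  ext
  exact (σ.commutes c).symm

end Place

/-- The divisor group of `F / K`: the free abelian group on the places. -/
abbrev Divisor (K F : Type*) [Field K] [Field F] [Algebra K F] : Type _ := Place K F →₀ ℤ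

namespace Divisor

variable {K F : Type*} [Field K] [Field F] [Algebra K F]

/-- The degree `∑ n_P deg P` of a divisor `∑ n_P P`. -/
noncomputable def degree : Divisor K F →+ ℤ :=
  Finsupp.liftAddHom fun P => AddMonoidHom.mulRight (P.degree : ℤ)

/-- `D.IsDivisorOf f` says that `f` is non-zero with divisor `(f) = D`. -/
def IsDivisorOf (D : Divisor K F) (f : F) : Prop :=
  f ≠ 0 ∧ ∀ P : Place K F, P.IsOrd f (D P)

/-- The induced action of an automorphism on divisors, `∑ n_P P ↦ ∑ n_P σ(P)`. -/
noncomputable def map (σ : F ≃ₐ[K] F) : Divisor K F →+ Divisor K F :=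
  Finsupp.mapDomain.addMonoidHom (Place.map σ)

theorem degree_map (σ : F ≃ₐ[K] F) (D : Divisor K F) : degree (map σ D) = degree D := by
  have h : (degree (K := K) (F := F)).comp (map σ) = degree := by
    ext P
    simp [degree, map, Place.degree_map]
  exact DFunLike.congr_fun h D

end Divisor

/-- The group of principal divisors. (In a function field the divisors of non-zero functions
already form a group.) -/
noncomputable def Princ (K F : Type*) [Field K] [Field F] [Algebra K F] : AddSubgroup (Divisor K F) :=
  AddSubgroup.closure {D | ∃ f : F, D.IsDivisorOf f}

/-- The group of divisors of degree zero. -/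
noncomputable def Div0 (K F : Type*) [Field K] [Field F] [Algebra K F] :
    AddSubgroup (Divisor K F) :=
  (Divisor.degree (K := K) (F := F)).ker

/-- The group `Cl⁰(F)` of divisor classes of degree zero. -/
abbrev Cl0 (K F : Type*) [Field K] [Field F] [Algebra K F] : Type _ :=
  Div0 K F ⧸ (Princ K F).addSubgroupOf (Div0 K F)

/-- The class of a divisor of degree zero. -/
noncomputable def Cl0.mk {K F : Type*} [Field K] [Field F] [Algebra K F] (D : Div0 K F) : Cl0 K F :=
  QuotientAddGroup.mk D

/-- The induced action of an automorphism on divisors of degree zero. -/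
noncomputable def Div0.map {K F : Type*} [Field K] [Field F] [Algebra K F] (σ : F ≃ₐ[K] F)
    (D : Div0 K F) : Div0 K F :=
  ⟨Divisor.map σ D, (Divisor.degree_map σ (D : Divisor K F)).trans D.2⟩

end FunctionFieldDivisor

/-! Only one place `P∞` is a pole of `x`; there `x` has pole order `q` and `y` has pole order `q +
1`. Modulo the equation, every polynomial in `x, y` is a combination of monomials `x ^ i * y ^ j`
with `j < q`, whose pole orders `q * i + (q + 1) * j` are pairwise distinct, since they are `j`
modulo `q`. As `K[x, y]` is integrally closed, these combinations are all the functions with poles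
only at `P∞`. For `q > 2` this gives `L(2 P∞) = K` and `L(2q P∞) = ⟨1, x, x², y⟩`.

Statement (2), in `mem_range_of_sum_posPart_le`: let `f` have at most two zeros with multiplicity,
all rational. Multiplying `1 / f` by factors `x - x(P)` for the affine zeros `P` gives an element
`p(x) + c * y` of `L(2q P∞)`. If `P` is an affine zero over `x = a`, that fibre has more than two
rational points `(a, b)`. The product vanishes at those other than `P`, so `p(a) + c * b = 0` for
two values of `b`, and `c = 0`. Then `f` lies in `K(x)`, so it vanishes on the whole fibre, at more
than two places. Hence there is no affine zero, `1 / f` lies in `L(2 P∞)`, and `f` is constant.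

Statement (1): if `σ` acts trivially on classes and `P ≠ Q` are rational, then `σP - σQ - P + Q` is
principal with at most two zeros, hence zero, and `σP = P`. So `σ` fixes all rational places. Then
`σx - x` and `σy - y` lie in `L(2q P∞)` and vanish at all affine rational points, which forces them
to be zero.

Places are supplied by valuation rings dominating a proper ideal. Their uniqueness, uniformizers and
degree one all follow from one fact: every non-zero function has a leading term `c * t ^ n`, the
same at all candidate places (`HasLeadingTerm`). -/

namespace FunctionFieldDivisor

/-! ### Valuations and orders at a place -/

namespace Place

variable {K F : Type*} [Field K] [Field F] [Algebra K F]

theorem valuation_algebraMap (P : Place K F) {c : K} (hc : c ≠ 0) :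
    P.ring.valuation (algebraMap K F c) = 1 := by
  refine le_antisymm ((P.ring.valuation_le_one_iff _).2 (P.algebraMap_mem c)) ?_
  have h := (P.ring.valuation_le_one_iff _).2 (P.algebraMap_mem c⁻¹)
  have h0 : algebraMap K F c ≠ 0 := (map_ne_zero _).2 hc
  rwa [Valuation.one_le_val_iff _ h0, ← map_inv₀]

theorem valuation_algebraMap_le_one (P : Place K F) (c : K) :
    P.ring.valuation (algebraMap K F c) ≤ 1 :=
  (P.ring.valuation_le_one_iff _).2 (P.algebraMap_mem c)

theorem eq_zero_of_valuation_algebraMap_lt_one (P : Place K F) {c : K}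
    (h : P.ring.valuation (algebraMap K F c) < 1) : c = 0 := by
  by_contra hc
  exact h.ne (P.valuation_algebraMap hc)

theorem valuation_lt_one_of_span {P : Place K F} {t : P.ring}
    (ht : IsLocalRing.maximalIdeal P.ring = Ideal.span {t}) : P.ring.valuation (t : F) < 1 := by
  rw [← P.ring.valuation_lt_one_iff, ht]
  exact Ideal.mem_span_singleton_self t

theorem valuation_le_of_span {P : Place K F} {t : P.ring}
    (ht : IsLocalRing.maximalIdeal P.ring = Ideal.span {t}) {s : F}
    (hs : P.ring.valuation s < 1) : P.ring.valuation s ≤ P.ring.valuation (t : F) := by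
  have hs1 : s ∈ P.ring := (P.ring.valuation_le_one_iff _).1 hs.le
  have hs2 : (⟨s, hs1⟩ : P.ring) ∈ IsLocalRing.maximalIdeal P.ring :=
    (P.ring.valuation_lt_one_iff _).2 hs
  rw [ht, Ideal.mem_span_singleton'] at hs2
  obtain ⟨a, ha⟩ := hs2
  have ha' : (a : F) * t = s := congrArg Subtype.val ha
  exact (P.ring.valuation_le_iff _ _).2 ⟨a, ha'⟩

theorem exists_valuation_lt_one (P : Place K F) : ∃ s : F, s ≠ 0 ∧ P.ring.valuation s < 1 := by
  by_contra! h
  refine P.ne_top (top_unique fun f _ => ?_)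
  by_cases hf : f = 0
  · rw [hf]
    exact P.ring.zero_mem
  · have := h f⁻¹ (inv_ne_zero hf)
    rwa [Valuation.one_le_val_iff _ (inv_ne_zero hf), inv_inv, P.ring.valuation_le_one_iff] at this

/-- A proper valuation ring is not a field, so its maximal ideal is non-zero. -/
theorem ne_zero_of_span {P : Place K F} {t : P.ring}
    (ht : IsLocalRing.maximalIdeal P.ring = Ideal.span {t}) : (t : F) ≠ 0 := by
  obtain ⟨s, hs0, hs⟩ := P.exists_valuation_lt_one
  intro h
  have := valuation_le_of_span ht hs
  rw [h, map_zero, le_zero_iff, map_eq_zero] at this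
  exact hs0 this

/-- `IsOrd` chooses its own uniformizer; this makes orders taken with different choices comparable.
-/
theorem valuation_eq_of_span {P : Place K F} {t t' : P.ring}
    (ht : IsLocalRing.maximalIdeal P.ring = Ideal.span {t})
    (ht' : IsLocalRing.maximalIdeal P.ring = Ideal.span {t'}) :
    P.ring.valuation (t : F) = P.ring.valuation (t' : F) :=
  le_antisymm (valuation_le_of_span ht' (valuation_lt_one_of_span ht))
    (valuation_le_of_span ht (valuation_lt_one_of_span ht'))

theorem strictAnti_zpow_valuation (P : Place K F) {t : F} (h0 : t ≠ 0)
    (ht : P.ring.valuation t < 1) : StrictAnti fun n : ℤ => P.ring.valuation t ^ n :=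
  zpow_right_strictAnti₀ ((Valuation.pos_iff _).2 h0) ht

theorem IsOrd.valuation_eq {P : Place K F} {f : F} {n : ℤ} (hf : P.IsOrd f n) {t : P.ring}
    (ht : IsLocalRing.maximalIdeal P.ring = Ideal.span {t}) :
    P.ring.valuation f = P.ring.valuation (t : F) ^ n := by
  obtain ⟨s, hs, h⟩ := hf
  rw [h, valuation_eq_of_span hs ht]

theorem IsOrd.mul {P : Place K F} {f g : F} {m n : ℤ} (hf : P.IsOrd f m) (hg : P.IsOrd g n) :
    P.IsOrd (f * g) (m + n) := by
  obtain ⟨t, ht, h⟩ := hf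
  exact ⟨t, ht, by
    rw [map_mul, h, hg.valuation_eq ht, zpow_add₀ ((Valuation.ne_zero_iff _).2 (ne_zero_of_span ht))]⟩

theorem IsOrd.inv {P : Place K F} {f : F} {n : ℤ} (hf : P.IsOrd f n) : P.IsOrd f⁻¹ (-n) := by
  obtain ⟨t, ht, h⟩ := hf
  exact ⟨t, ht, by rw [map_inv₀, h, zpow_neg]⟩

theorem IsOrd.unique {P : Place K F} {f : F} {m n : ℤ} (h : P.IsOrd f m) (h' : P.IsOrd f n) :
    m = n := by
  obtain ⟨t, ht, h⟩ := h
  rw [h'.valuation_eq ht] at h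
  exact ((P.strictAnti_zpow_valuation (ne_zero_of_span ht) (valuation_lt_one_of_span ht)).injective
    h).symm

theorem IsOrd.one_lt_valuation_iff {P : Place K F} {f : F} {n : ℤ} (hf : P.IsOrd f n) :
    1 < P.ring.valuation f ↔ n < 0 := by
  obtain ⟨t, ht, h⟩ := hf
  rw [h, ← zpow_zero (P.ring.valuation (t : F))]
  exact (P.strictAnti_zpow_valuation (ne_zero_of_span ht)
    (valuation_lt_one_of_span ht)).lt_iff_gt

theorem mem_ring_map {σ : F ≃ₐ[K] F} {P : Place K F} {f : F} :
    σ f ∈ (P.map σ).ring ↔ f ∈ P.ring := by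
  rw [mem_map_ring, σ.symm_apply_apply]

theorem IsOrd.map {P : Place K F} {f : F} {n : ℤ} (hf : P.IsOrd f n) (σ : F ≃ₐ[K] F) :
    (P.map σ).IsOrd (σ f) n := by
  obtain ⟨t, ht, h⟩ := hf
  refine ⟨ringEquivMap σ P t, ?_, ?_⟩
  · ext s
    obtain ⟨s, rfl⟩ := (ringEquivMap σ P).surjective s
    rw [Ideal.mem_span_singleton, map_dvd_iff, ← Ideal.mem_span_singleton, ← ht,
      IsLocalRing.mem_maximalIdeal, IsLocalRing.mem_maximalIdeal, mem_nonunits_iff,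
      mem_nonunits_iff, MulEquiv.isUnit_map]
  · have h0 : (t : F) ≠ 0 := ne_zero_of_span ht
    rw [← map_zpow₀] at h ⊢
    rw [ValuationSubring.valuation_eq_iff] at h ⊢
    obtain ⟨a, ha⟩ := h
    refine ⟨Units.map (ringEquivMap σ P : P.ring →* (P.map σ).ring) a, ?_⟩
    change σ (a : F) * (σ (t : F)) ^ n = σ f
    rw [← ha, map_mul, map_zpow₀]

theorem map_one (P : Place K F) : P.map (1 : F ≃ₐ[K] F) = P := by
  ext f
  exact mem_map_ring _ _ _

theorem map_mul (σ τ : F ≃ₐ[K] F) (P : Place K F) : P.map (σ * τ) = (P.map τ).map σ := by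
  ext f
  rfl

theorem valuation_map_lt_one_iff {σ : F ≃ₐ[K] F} {P : Place K F} {f : F} :
    (P.map σ).ring.valuation (σ f) < 1 ↔ P.ring.valuation f < 1 := by
  rw [← ValuationSubring.mem_nonunits_iff, ← ValuationSubring.mem_nonunits_iff,
    ValuationSubring.mem_nonunits_iff_or, ValuationSubring.mem_nonunits_iff_or, ← map_inv₀,
    mem_ring_map, map_eq_zero_iff _ σ.injective]

theorem degree_eq_one_iff {P : Place K F} :
    P.degree = 1 ↔ ∀ f ∈ P.ring, ∃ c : K, P.ring.valuation (f - algebraMap K F c) < 1 := by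
  have key : ∀ (f : P.ring) (c : K), P.ring.valuation ((f : F) - algebraMap K F c) < 1 ↔
      algebraMap K (IsLocalRing.ResidueField P.ring) c = IsLocalRing.residue _ f := by
    intro f c
    have h : algebraMap K (IsLocalRing.ResidueField P.ring) c =
      IsLocalRing.residue P.ring (algebraMap K P.ring c) := rfl
    rw [h, eq_comm, ← sub_eq_zero, ← _root_.map_sub, IsLocalRing.residue_eq_zero_iff,
      P.ring.valuation_lt_one_iff]
    rfl
  rw [degree, ← Subalgebra.bot_eq_top_iff_finrank_eq_one, Algebra.eq_top_iff]
  constructor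
  · intro h f hf
    obtain ⟨c, hc⟩ := Algebra.mem_bot.1 (h (IsLocalRing.residue _ ⟨f, hf⟩))
    exact ⟨c, (key ⟨f, hf⟩ c).2 hc⟩
  · intro h s
    obtain ⟨f, rfl⟩ := IsLocalRing.residue_surjective s
    obtain ⟨c, hc⟩ := h f f.2
    exact Algebra.mem_bot.2 ⟨c, (key f c).1 hc⟩

end Place

/-! ### Principal divisors and the action on divisor classes -/

namespace Divisor

variable {K F : Type*} [Field K] [Field F] [Algebra K F]

theorem IsDivisorOf.mul {D E : Divisor K F} {f g : F} (hf : D.IsDivisorOf f)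
    (hg : E.IsDivisorOf g) : (D + E).IsDivisorOf (f * g) :=
  ⟨mul_ne_zero hf.1 hg.1, fun P => (hf.2 P).mul (hg.2 P)⟩

theorem IsDivisorOf.inv {D : Divisor K F} {f : F} (hf : D.IsDivisorOf f) :
    (-D).IsDivisorOf f⁻¹ :=
  ⟨inv_ne_zero hf.1, fun P => (hf.2 P).inv⟩

theorem map_apply (σ : F ≃ₐ[K] F) (D : Divisor K F) (P : Place K F) :
    map σ D (P.map σ) = D P := by
  refine Finsupp.mapDomain_apply (fun P Q h => ?_) D P
  rw [← P.map_one, ← Q.map_one, ← inv_mul_cancel σ, Place.map_mul, Place.map_mul, h]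

theorem map_one (D : Divisor K F) : map (1 : F ≃ₐ[K] F) D = D := by
  change Finsupp.mapDomain _ D = D
  rw [funext Place.map_one]
  exact Finsupp.mapDomain_id

theorem map_mul (σ τ : F ≃ₐ[K] F) (D : Divisor K F) : map (σ * τ) D = map σ (map τ D) := by
  change Finsupp.mapDomain _ D = Finsupp.mapDomain _ (Finsupp.mapDomain _ D)
  rw [← Finsupp.mapDomain_comp, funext (Place.map_mul σ τ)]
  rfl

theorem IsDivisorOf.map {D : Divisor K F} {f : F} (hf : D.IsDivisorOf f) (σ : F ≃ₐ[K] F) :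
    (Divisor.map σ D).IsDivisorOf (σ f) := by
  refine ⟨(map_ne_zero _).2 hf.1, fun P => ?_⟩
  have hP : P = (P.map σ⁻¹).map σ := by rw [← Place.map_mul, mul_inv_cancel, Place.map_one]
  rw [hP, map_apply]
  exact (hf.2 _).map σ

end Divisor

variable {K F : Type*} [Field K] [Field F] [Algebra K F]

theorem map_mem_princ (σ : F ≃ₐ[K] F) {D : Divisor K F} (hD : D ∈ Princ K F) :
    Divisor.map σ D ∈ Princ K F := by
  have h : Princ K F ≤ (Princ K F).comap (Divisor.map σ) := by
    refine (AddSubgroup.closure_le _).2 ?_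
    rintro D ⟨f, hf⟩
    exact AddSubgroup.subset_closure ⟨σ f, hf.map σ⟩
  exact h hD

/-- Divisors of functions are closed under sums and negatives. Zero is kept apart: for it to be the
divisor of `1`, `IsOrd` would require a uniformizer at every place. -/
theorem eq_zero_or_exists_isDivisorOf_of_mem_princ {D : Divisor K F} (hD : D ∈ Princ K F) :
    D = 0 ∨ ∃ f : F, D.IsDivisorOf f := by
  induction hD using AddSubgroup.closure_induction with
  | mem D h => exact .inr h
  | zero => exact .inl rfl
  | add D E _ _ hD hE =>
    rcases hD with rfl | ⟨f, hf⟩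
    · rwa [zero_add]
    rcases hE with rfl | ⟨g, hg⟩
    · exact .inr ⟨f, by rwa [add_zero]⟩
    · exact .inr ⟨f * g, hf.mul hg⟩
  | neg D _ hD =>
    rcases hD with rfl | ⟨f, hf⟩
    · exact .inl neg_zero
    · exact .inr ⟨f⁻¹, hf.inv⟩

/-- The action of an automorphism on divisors of degree zero, as a homomorphism. -/
noncomputable def Div0.mapHom (σ : F ≃ₐ[K] F) : Div0 K F →+ Div0 K F where
  toFun := Div0.map σ
  map_zero' := Subtype.ext (_root_.map_zero (Divisor.map σ))
  map_add' D E := Subtype.ext (_root_.map_add (Divisor.map σ) (D : Divisor K F) E)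

/-- The action of an automorphism on divisor classes of degree zero. -/
noncomputable def Cl0.map (σ : F ≃ₐ[K] F) : Cl0 K F →+ Cl0 K F :=
  QuotientAddGroup.map _ _ (Div0.mapHom σ) fun _ hD => map_mem_princ σ hD

theorem Cl0.map_one (D : Cl0 K F) : Cl0.map (1 : F ≃ₐ[K] F) D = D := by
  obtain ⟨D, rfl⟩ := QuotientAddGroup.mk_surjective D
  exact congrArg Cl0.mk (Subtype.ext (Divisor.map_one (D : Divisor K F)))

theorem Cl0.map_mul (σ τ : F ≃ₐ[K] F) (D : Cl0 K F) :
    Cl0.map (σ * τ) D = Cl0.map σ (Cl0.map τ D) := by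
  obtain ⟨D, rfl⟩ := QuotientAddGroup.mk_surjective D
  exact congrArg Cl0.mk (Subtype.ext (Divisor.map_mul σ τ (D : Divisor K F)))

/-- The automorphism group of `F / K` acts on the divisor classes of degree zero. -/
noncomputable def Cl0.autHom (K F : Type*) [Field K] [Field F] [Algebra K F] :
    (F ≃ₐ[K] F) →* Multiplicative (AddAut (Cl0 K F)) where
  toFun σ := Multiplicative.ofAdd
    { Cl0.map σ with
      invFun := Cl0.map σ⁻¹
      left_inv := fun D => by
        change Cl0.map σ⁻¹ (Cl0.map σ D) = D
        rw [← Cl0.map_mul, inv_mul_cancel, Cl0.map_one]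
      right_inv := fun D => by
        change Cl0.map σ (Cl0.map σ⁻¹ D) = D
        rw [← Cl0.map_mul, mul_inv_cancel, Cl0.map_one] }
  map_one' := AddEquiv.ext fun D => Cl0.map_one D
  map_mul' σ τ := AddEquiv.ext fun D => Cl0.map_mul σ τ D

theorem Cl0.autHom_apply_mk (σ : F ≃ₐ[K] F) (D : Div0 K F) :
    (Cl0.autHom K F σ).toAdd (Cl0.mk D) = Cl0.mk (Div0.map σ D) := rfl

end FunctionFieldDivisor

/-! ### Leading terms, uniform over a set of places -/

namespace FunctionFieldDivisor

variable {K F : Type*} [Field K] [Field F] [Algebra K F]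

/-- `HasLeadingTerm S t h n c` says that `c * t ^ n` with `c ≠ 0` is the leading term of `h` at all
places in `S`. -/
def HasLeadingTerm (S : Set (Place K F)) (t h : F) (n : ℤ) (c : K) : Prop :=
  c ≠ 0 ∧ ∀ P ∈ S, P.ring.valuation (h - algebraMap K F c * t ^ n) < P.ring.valuation t ^ n

namespace HasLeadingTerm

variable {S : Set (Place K F)} {t h h' : F} {n n' : ℤ} {c c' : K}

theorem valuation_term (hc : c ≠ 0) (P : Place K F) :
    P.ring.valuation (algebraMap K F c * t ^ n) = P.ring.valuation t ^ n := by
  rw [map_mul, P.valuation_algebraMap hc, one_mul, map_zpow₀]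

theorem valuation_eq (hh : HasLeadingTerm S t h n c) {P : Place K F} (hP : P ∈ S) :
    P.ring.valuation h = P.ring.valuation t ^ n := by
  have h1 := hh.2 P hP
  rw [← valuation_term hh.1 P] at h1 ⊢
  exact Valuation.map_eq_of_sub_lt _ h1

theorem mono {T : Set (Place K F)} (hh : HasLeadingTerm S t h n c) (hT : T ⊆ S) :
    HasLeadingTerm T t h n c :=
  ⟨hh.1, fun P hP => hh.2 P (hT hP)⟩

theorem mul (hh : HasLeadingTerm S t h n c) (hh' : HasLeadingTerm S t h' n' c') (ht : t ≠ 0) :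
    HasLeadingTerm S t (h * h') (n + n') (c * c') := by
  refine ⟨mul_ne_zero hh.1 hh'.1, fun P hP => ?_⟩
  have h0 : P.ring.valuation t ≠ 0 := (Valuation.ne_zero_iff _).2 ht
  have e : h * h' - algebraMap K F (c * c') * t ^ (n + n') =
      (h - algebraMap K F c * t ^ n) * h' +
        algebraMap K F c * t ^ n * (h' - algebraMap K F c' * t ^ n') := by
    rw [zpow_add₀ ht, map_mul]
    ring
  rw [e, zpow_add₀ h0]
  refine Valuation.map_add_lt _ ?_ ?_
  · rw [map_mul, hh'.valuation_eq hP]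
    exact mul_lt_mul_of_pos_right (hh.2 P hP) (zpow_pos (zero_lt_iff.2 h0) _)
  · rw [map_mul, valuation_term hh.1]
    exact mul_lt_mul_of_pos_left (hh'.2 P hP) (zpow_pos (zero_lt_iff.2 h0) _)

theorem inv (hh : HasLeadingTerm S t h n c) (ht : t ≠ 0) :
    HasLeadingTerm S t h⁻¹ (-n) c⁻¹ := by
  refine ⟨inv_ne_zero hh.1, fun P hP => ?_⟩
  have h0 : P.ring.valuation t ≠ 0 := (Valuation.ne_zero_iff _).2 ht
  have hn : P.ring.valuation t ^ n ≠ 0 := zpow_ne_zero _ h0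
  have hv := hh.valuation_eq hP
  have hne : h ≠ 0 := by
    rintro rfl
    rw [map_zero] at hv
    exact hn hv.symm
  have hc : algebraMap K F c ≠ 0 := (map_ne_zero _).2 hh.1
  have htn : t ^ n ≠ 0 := zpow_ne_zero _ ht
  have e : h⁻¹ - algebraMap K F c⁻¹ * t ^ (-n) =
      -((h - algebraMap K F c * t ^ n) * (h⁻¹ * (algebraMap K F c * t ^ n)⁻¹)) := by
    rw [zpow_neg, map_inv₀]
    field_simp
    ring
  rw [e, Valuation.map_neg, map_mul, map_mul, map_inv₀, map_inv₀, valuation_term hh.1, hv, zpow_neg,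
    ← mul_assoc]
  calc _ < P.ring.valuation t ^ n * (P.ring.valuation t ^ n)⁻¹ * (P.ring.valuation t ^ n)⁻¹ := by
        refine mul_lt_mul_of_pos_right (mul_lt_mul_of_pos_right (hh.2 P hP) ?_) ?_ <;>
        exact inv_pos.2 (zero_lt_iff.2 hn)
    _ = _ := by rw [mul_inv_cancel₀ hn, one_mul]

theorem algebraMap (hc : c ≠ 0) :
    HasLeadingTerm S t (algebraMap K F c) 0 c :=
  ⟨hc, fun P _ => by simp⟩

theorem self (ht : t ≠ 0) : HasLeadingTerm S t t 1 1 :=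
  ⟨one_ne_zero, fun P _ => by
    simpa using zero_lt_iff.2 ((Valuation.ne_zero_iff P.ring.valuation).2 ht)⟩

theorem pow (hh : HasLeadingTerm S t h n c) (ht : t ≠ 0) (k : ℕ) :
    HasLeadingTerm S t (h ^ k) (k * n) (c ^ k) := by
  induction k with
  | zero => simpa using algebraMap (S := S) (t := t) (one_ne_zero (α := K))
  | succ k ih =>
    rw [pow_succ, pow_succ, Nat.cast_succ, add_mul, one_mul]
    exact ih.mul hh ht

theorem add_of_lt (hh : HasLeadingTerm S t h n c)
    (hh' : ∀ P ∈ S, P.ring.valuation h' < P.ring.valuation t ^ n) :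
    HasLeadingTerm S t (h + h') n c :=
  ⟨hh.1, fun P hP => by
    rw [add_sub_right_comm]
    exact Valuation.map_add_lt _ (hh.2 P hP) (hh' P hP)⟩

/-- Distinct exponents exclude cancellation, so the summand with the smallest exponent dominates. -/
theorem exists_sum {ι : Type*} {s : Finset ι} (hs : s.Nonempty) {f : ι → F} {n : ι → ℤ} {c : ι → K}
    (hf : ∀ i ∈ s, HasLeadingTerm S t (f i) (n i) (c i)) (hn : Set.InjOn n s) (ht : t ≠ 0)
    (ht1 : ∀ P ∈ S, P.ring.valuation t < 1) :
    ∃ i ∈ s, HasLeadingTerm S t (∑ i ∈ s, f i) (n i) (c i) ∧ ∀ j ∈ s, n i ≤ n j := by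
  classical
  obtain ⟨i, hi, hmin⟩ := s.exists_min_image n hs
  refine ⟨i, hi, ?_, hmin⟩
  rw [← Finset.add_sum_erase s f hi]
  refine (hf i hi).add_of_lt fun P hP => ?_
  refine Valuation.map_sum_lt _ (zpow_ne_zero _ ((Valuation.ne_zero_iff _).2 ht)) fun j hj => ?_
  rw [Finset.mem_erase] at hj
  rw [(hf j hj.2).valuation_eq hP]
  exact P.strictAnti_zpow_valuation ht (ht1 P hP)
    (lt_of_le_of_ne (hmin j hj.2) fun e => hj.1 (hn hj.2 hi e.symm))

theorem ne_zero (hh : HasLeadingTerm S t h n c) (hS : S.Nonempty) (ht : t ≠ 0) : h ≠ 0 := by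
  obtain ⟨P, hP⟩ := hS
  rintro rfl
  have := hh.valuation_eq hP
  rw [_root_.map_zero] at this
  exact zpow_ne_zero _ ((Valuation.ne_zero_iff _).2 ht) this.symm

theorem exponent_eq (hh : HasLeadingTerm S t h n c) {P : Place K F} (hP : P ∈ S) (ht : t ≠ 0)
    (ht1 : P.ring.valuation t < 1) (hv : P.ring.valuation h = P.ring.valuation t ^ n') : n = n' :=
  (P.strictAnti_zpow_valuation ht ht1).injective ((hh.valuation_eq hP).symm.trans hv)

theorem valuation_le_one_iff (hh : HasLeadingTerm S t h n c) {P : Place K F} (hP : P ∈ S)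
    (ht : t ≠ 0) (ht1 : P.ring.valuation t < 1) : P.ring.valuation h ≤ 1 ↔ 0 ≤ n := by
  rw [hh.valuation_eq hP, ← zpow_zero (P.ring.valuation t)]
  exact (P.strictAnti_zpow_valuation ht ht1).le_iff_ge

end HasLeadingTerm

section

variable {S : Set (Place K F)} {t : F}

/-- Membership in the valuation ring is the condition `0 ≤ n` on the exponent, which does not depend
on the place in `S`. -/
theorem subsingleton_of_hasLeadingTerm (ht : t ≠ 0) (ht1 : ∀ P ∈ S, P.ring.valuation t < 1)
    (hS : ∀ h : F, h ≠ 0 → ∃ n c, HasLeadingTerm S t h n c) : S.Subsingleton := by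
  intro P hP Q hQ
  ext h
  by_cases h0 : h = 0
  · simp [h0, P.ring.zero_mem, Q.ring.zero_mem]
  · obtain ⟨n, c, hh⟩ := hS h h0
    rw [← P.ring.valuation_le_one_iff, ← Q.ring.valuation_le_one_iff,
      hh.valuation_le_one_iff hP ht (ht1 P hP), hh.valuation_le_one_iff hQ ht (ht1 Q hQ)]

variable {P : Place K F}

theorem maximalIdeal_eq_span_of_hasLeadingTerm (hP : P ∈ S) (ht : t ≠ 0)
    (ht1 : P.ring.valuation t < 1)
    (hS : ∀ h : F, h ≠ 0 → ∃ n c, HasLeadingTerm S t h n c) :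
    ∃ s : P.ring, (s : F) = t ∧ IsLocalRing.maximalIdeal P.ring = Ideal.span {s} := by
  refine ⟨⟨t, (P.ring.valuation_le_one_iff t).1 ht1.le⟩, rfl, ?_⟩
  ext f
  rw [P.ring.valuation_lt_one_iff, Ideal.mem_span_singleton']
  constructor
  · intro hf
    by_cases h0 : (f : F) = 0
    · exact ⟨0, by rw [zero_mul]; exact (Subtype.ext h0).symm⟩
    obtain ⟨n, c, hh⟩ := hS f h0
    have hn : 1 ≤ n := by
      rw [hh.valuation_eq hP, ← zpow_zero (P.ring.valuation t)] at hf
      exact (P.strictAnti_zpow_valuation ht ht1).lt_iff_gt.1 hf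
    have hle : P.ring.valuation (f : F) ≤ P.ring.valuation t := by
      rw [hh.valuation_eq hP]
      simpa using (P.strictAnti_zpow_valuation ht ht1).antitone hn
    obtain ⟨a, ha⟩ := (P.ring.valuation_le_iff _ _).1 hle
    exact ⟨a, Subtype.ext ha⟩
  · rintro ⟨a, rfl⟩
    change P.ring.valuation (a * t) < 1
    rw [map_mul]
    exact (mul_le_of_le_one_left' (P.ring.valuation_le_one a)).trans_lt ht1

/-- A unit of the valuation ring has exponent `0`, so its leading coefficient is a constant
congruent to it. -/
theorem degree_eq_one_of_hasLeadingTerm (hP : P ∈ S) (ht : t ≠ 0) (ht1 : P.ring.valuation t < 1)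
    (hS : ∀ h : F, h ≠ 0 → ∃ n c, HasLeadingTerm S t h n c) : P.degree = 1 := by
  refine Place.degree_eq_one_iff.2 fun f hf => ?_
  rw [← P.ring.valuation_le_one_iff] at hf
  by_cases h1 : P.ring.valuation f < 1
  · exact ⟨0, by simpa using h1⟩
  have h0 : f ≠ 0 := by
    rintro rfl
    simp at h1
  obtain ⟨n, c, hh⟩ := hS f h0
  have hn : n = 0 := hh.exponent_eq hP ht ht1 (by rw [zpow_zero]; exact le_antisymm hf (not_lt.1 h1))
  subst hn
  exact ⟨c, by simpa using hh.2 P hP⟩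

end

end FunctionFieldDivisor

/-! ### The Hermitian equation and polynomials in `x` and `y` -/

open Polynomial FunctionFieldDivisor

/-- The polynomial `Y ^ q + Y - X ^ (q + 1)`. -/
noncomputable def hermitianPolynomial (q : ℕ) (K : Type*) [Field K] : K[X][X] :=
  X ^ q + X - C (X ^ (q + 1))

/-- Generators `x`, `y` of a Hermitian function field. -/
structure HermitianGenerators (q : ℕ) (K : Type*) {H : Type*} [Field K] [Field H] [Algebra K H]
    (x y : H) : Prop where
  two_lt : 2 < q
  cast_eq_zero : (q : K) = 0
  transcendental : Transcendental K x
  eq : y ^ q + y = x ^ (q + 1)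
  adjoin_eq_top : IntermediateField.adjoin K {x, y} = ⊤
  sub_pow : ∀ a b : H, (a - b) ^ q = a ^ q - b ^ q
  exists_roots : ∀ a : K, ∃ s : Finset K, 2 < s.card ∧ ∀ b ∈ s, b ^ q + b = a ^ (q + 1)

/-- Evaluation of polynomials in two variables at `(x, y)`. -/
noncomputable def evalPair (K : Type*) {H : Type*} [Field K] [Field H] [Algebra K H] (x y : H) :
    K[X][X] →+* H :=
  eval₂RingHom (aeval x : K[X] →ₐ[K] H).toRingHom y

/-- The places at which `x` has a pole. -/
def placesAtInfinity (K : Type*) {H : Type*} [Field K] [Field H] [Algebra K H] (x : H) :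
    Set (Place K H) :=
  {P | x ∉ P.ring}

theorem one_lt_valuation_of_mem_placesAtInfinity {K H : Type*} [Field K] [Field H] [Algebra K H]
    {x : H} {P : Place K H} (hP : P ∈ placesAtInfinity K x) :
    1 < P.ring.valuation x := by
  rw [← not_le, P.ring.valuation_le_one_iff]
  exact hP

section evalPair

variable {K H : Type*} [Field K] [Field H] [Algebra K H] (x y : H)

theorem evalPair_C (p : K[X]) : evalPair K x y (C p) = aeval x p := by simp [evalPair]

theorem evalPair_X : evalPair K x y X = y := by simp [evalPair]

theorem evalPair_eq_sum (B : K[X][X]) :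
    evalPair K x y B = ∑ j ∈ B.support, aeval x (B.coeff j) * y ^ j := by
  simp [evalPair, eval₂_eq_sum, Polynomial.sum]

theorem aeval_mem_place {P : Place K H} (hx : x ∈ P.ring) (p : K[X]) : aeval x p ∈ P.ring := by
  rw [aeval_eq_sum_range]
  refine sum_mem fun i _ => ?_
  rw [Algebra.smul_def]
  exact mul_mem (P.algebraMap_mem _) (pow_mem hx i)

theorem evalPair_mem_place {P : Place K H} (hx : x ∈ P.ring) (hy : y ∈ P.ring) (B : K[X][X]) :
    evalPair K x y B ∈ P.ring := by
  rw [evalPair_eq_sum]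
  exact sum_mem fun i _ => mul_mem (aeval_mem_place x hx _) (pow_mem hy i)

end evalPair

section hermitianPolynomial

variable {q : ℕ} {K : Type*} [Field K]

theorem hermitianPolynomial_eq : hermitianPolynomial q K = X ^ q + (X - C (X ^ (q + 1))) :=
  add_sub_assoc _ _ _

theorem monic_hermitianPolynomial (hq : 2 < q) : (hermitianPolynomial q K).Monic := by
  rw [hermitianPolynomial_eq]
  refine monic_X_pow_add ?_
  rw [degree_X_sub_C]
  exact_mod_cast (by omega : 1 < q)

theorem natDegree_hermitianPolynomial (hq : 2 < q) : (hermitianPolynomial q K).natDegree = q := by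
  rw [hermitianPolynomial_eq, natDegree_add_eq_left_of_natDegree_lt, natDegree_X_pow]
  rw [natDegree_X_pow, natDegree_X_sub_C]
  omega

/-- The derivative in `Y` is `1`, because `q = 0` in `K`: no fibre of `x` over the affine line
ramifies. -/
theorem separable_map_hermitianPolynomial {k : Type*} [Field k] (hq : (q : K) = 0)
    (φ : K[X] →+* k) : ((hermitianPolynomial q K).map φ).Separable := by
  have hq0 : (q : k[X]) = 0 := by
    have : (q : k[X]) = ((C : k →+* k[X]).comp (φ.comp C)) (q : K) := by simp
    rw [this, hq, map_zero]
  have hder : derivative ((hermitianPolynomial q K).map φ) = 1 := by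
    rw [derivative_map]
    simp [hermitianPolynomial, -map_pow, derivative_X_pow, hq0]
  exact ⟨0, 1, by rw [hder]; simp⟩

end hermitianPolynomial

/-! ### The pole of `x`, and the ring `K[x, y]` -/

namespace HermitianGenerators

variable {q : ℕ} {K H : Type*} [Field K] [Field H] [Algebra K H] {x y : H}
  (hg : HermitianGenerators q K x y)

include hg

theorem x_ne_zero : x ≠ 0 := by
  rintro rfl
  exact hg.transcendental (isAlgebraic_zero)

theorem y_ne_zero : y ≠ 0 := by
  rintro rfl
  have := hg.eq
  rw [zero_pow (by have := hg.two_lt; omega), add_zero] at this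
  exact pow_ne_zero _ hg.x_ne_zero this.symm

theorem div_ne_zero : x / y ≠ 0 := _root_.div_ne_zero hg.x_ne_zero hg.y_ne_zero

theorem y_mem {P : Place K H} (hx : x ∈ P.ring) : y ∈ P.ring := by
  have hq := hg.two_lt
  rw [← P.ring.valuation_le_one_iff] at hx ⊢
  by_contra! h
  have h1 : P.ring.valuation y < P.ring.valuation (y ^ q) := by
    rw [map_pow]
    exact lt_self_pow₀ h (by omega)
  have h2 := congrArg P.ring.valuation hg.eq
  rw [Valuation.map_add_eq_of_lt_left _ h1, map_pow, map_pow] at h2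
  exact ((one_lt_pow₀ h (by omega)).trans_eq h2).not_ge (pow_le_one₀ zero_le hx)

theorem x_mem_of_y_mem {P : Place K H} (hy : y ∈ P.ring) : x ∈ P.ring := by
  have h : x ^ (q + 1) ∈ P.ring := by
    rw [← hg.eq]
    exact add_mem (pow_mem hy _) hy
  rw [← P.ring.valuation_le_one_iff, map_pow] at h
  rw [← P.ring.valuation_le_one_iff]
  exact (pow_le_one_iff (by omega)).1 h

theorem one_lt_valuation_y {P : Place K H} (hP : P ∈ placesAtInfinity K x) :
    1 < P.ring.valuation y := by
  rw [← not_le, P.ring.valuation_le_one_iff]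
  exact fun h => hP (hg.x_mem_of_y_mem h)

theorem valuation_div_lt_one {P : Place K H} (hP : P ∈ placesAtInfinity K x) :
    P.ring.valuation (x / y) < 1 := by
  have hq := hg.two_lt
  have hx := one_lt_valuation_of_mem_placesAtInfinity hP
  have hy0 : 0 < P.ring.valuation y := (Valuation.pos_iff _).2 hg.y_ne_zero
  rw [map_div₀, div_lt_one₀ hy0]
  by_contra! h
  have h1 : P.ring.valuation (y ^ q + y) ≤ P.ring.valuation x ^ q := by
    refine Valuation.map_add_le _ ?_ (h.trans (le_self_pow₀ hx.le (by omega)))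
    rw [map_pow]
    exact pow_le_pow_left₀ zero_le h q
  rw [hg.eq, map_pow] at h1
  exact h1.not_gt (pow_lt_pow_right₀ hx (Nat.lt_succ_self q))

/-- With `t = x / y`, the equation gives `x - t ^ (-q) = (x ^ (q + 1) - y ^ q) / x ^ q = y / x ^ q`,
which is smaller than `t ^ (-q) = y ^ q / x ^ q` because `y` has a pole. -/
theorem hasLeadingTerm_x : HasLeadingTerm (placesAtInfinity K x) (x / y) x (-q) (1 : K) := by
  refine ⟨one_ne_zero, fun P hP => ?_⟩
  have hx0 := hg.x_ne_zero
  have hy0 := hg.y_ne_zero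
  have hq := hg.two_lt
  have e : x - algebraMap K H 1 * (x / y) ^ (-q : ℤ) = y / x ^ q := by
    rw [_root_.map_one, one_mul, zpow_neg, zpow_natCast, div_pow, inv_div, eq_div_iff (by positivity),
      sub_mul, div_mul_cancel₀ _ (by positivity), ← pow_succ', ← hg.eq]
    ring
  have hxq : 0 < P.ring.valuation x ^ q := by
    rw [← map_pow]
    exact (Valuation.pos_iff _).2 (pow_ne_zero _ hx0)
  rw [e, zpow_neg, zpow_natCast, map_div₀, map_div₀, div_pow, inv_div, map_pow,
    div_lt_div_iff_of_pos_right hxq]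
  exact lt_self_pow₀ (hg.one_lt_valuation_y hP) (by omega)

theorem hasLeadingTerm_y :
    HasLeadingTerm (placesAtInfinity K x) (x / y) y (-(q + 1)) (1 : K) := by
  have h := hg.hasLeadingTerm_x.mul ((HasLeadingTerm.self hg.div_ne_zero).inv hg.div_ne_zero)
    hg.div_ne_zero
  have e : x * (x / y)⁻¹ = y := by
    rw [inv_div, mul_div_cancel₀ _ hg.x_ne_zero]
  rw [e, inv_one, mul_one] at h
  convert h using 1
  ring

theorem hasLeadingTerm_aeval {p : K[X]} (hp : p ≠ 0) :
    HasLeadingTerm (placesAtInfinity K x) (x / y) (aeval x p) (-(q * p.natDegree))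
      p.leadingCoeff := by
  have hq := hg.two_lt
  have ht := hg.div_ne_zero
  obtain ⟨i, hi, h, hmin⟩ := HasLeadingTerm.exists_sum (s := p.support)
    (support_nonempty.2 hp) (f := fun i => algebraMap K H (p.coeff i) * x ^ i)
    (n := fun i => 0 + i * (-q : ℤ)) (c := fun i => p.coeff i * 1 ^ i)
    (fun i hi => (HasLeadingTerm.algebraMap (mem_support_iff.1 hi)).mul
      (hg.hasLeadingTerm_x.pow ht i) ht)
    (fun i _ j _ hij => by
      have h0 : q ≠ 0 := by omega
      simpa [h0] using hij) ht
    (fun P hP => hg.valuation_div_lt_one hP)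
  have hi' : i = p.natDegree := by
    refine le_antisymm (le_natDegree_of_mem_supp i hi) ?_
    have := hmin _ (natDegree_mem_support_of_nonzero hp)
    simp only [zero_add, mul_neg, neg_le_neg_iff] at this
    exact_mod_cast le_of_mul_le_mul_right this (by positivity)
  subst hi'
  have e : aeval x p = ∑ i ∈ p.support, algebraMap K H (p.coeff i) * x ^ i := by
    rw [aeval_eq_sum_range, ← Finset.sum_subset p.supp_subset_range_natDegree_succ]
    · simp [Algebra.smul_def]
    · intro i _ hi
      simp [notMem_support_iff.1 hi]
  rw [e]
  convert h using 1
  · ring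
  · simp

/-- The term with `y ^ j` has pole order `q * deg + (q + 1) * j`, congruent to `j` modulo `q`. For
`j < q` these are distinct, so the pole order of the sum is the largest of them. -/
theorem exists_hasLeadingTerm_evalPair {B : K[X][X]} (hB : B ≠ 0) (hd : B.natDegree < q) :
    ∃ (n : ℕ) (c : K), HasLeadingTerm (placesAtInfinity K x) (x / y) (evalPair K x y B) (-n) c ∧
      ∀ j, B.coeff j ≠ 0 → q * (B.coeff j).natDegree + (q + 1) * j ≤ n := by
  have hq := hg.two_lt
  have ht := hg.div_ne_zero
  obtain ⟨i, hi, h, hmin⟩ := HasLeadingTerm.exists_sum (s := B.support)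
    (support_nonempty.2 hB) (f := fun j => aeval x (B.coeff j) * y ^ j)
    (n := fun j => -(q * (B.coeff j).natDegree : ℤ) + j * (-(q + 1) : ℤ))
    (c := fun j => (B.coeff j).leadingCoeff * 1 ^ j)
    (fun j hj => (hg.hasLeadingTerm_aeval (mem_support_iff.1 hj)).mul
      (hg.hasLeadingTerm_y.pow ht j) ht)
    (fun i hi j hj hij => by
      have hi' := (le_natDegree_of_mem_supp i hi).trans_lt hd
      have hj' := (le_natDegree_of_mem_supp j hj).trans_lt hd
      have e : i + q * ((B.coeff i).natDegree + i) = j + q * ((B.coeff j).natDegree + j) := by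
        zify
        simp only at hij
        linear_combination -hij
      have := congrArg (· % q) e
      simpa [Nat.mod_eq_of_lt hi', Nat.mod_eq_of_lt hj'] using this) ht
    (fun P hP => hg.valuation_div_lt_one hP)
  rw [← evalPair_eq_sum] at h
  refine ⟨q * (B.coeff i).natDegree + (q + 1) * i, (B.coeff i).leadingCoeff * 1 ^ i, ?_, fun j hj => ?_⟩
  · convert h using 1
    push_cast
    ring
  · have := hmin j (mem_support_iff.2 hj)
    zify
    linarith

/-- Since `x` is transcendental, `x⁻¹` is not a unit of `K[x⁻¹]`, and some valuation ring containing
`K[x⁻¹]` has `x⁻¹` in its maximal ideal. -/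
theorem placesAtInfinity_nonempty : (placesAtInfinity K x).Nonempty := by
  let A : Subring H := (Algebra.adjoin K {x⁻¹}).toSubring
  have hx : x⁻¹ ∈ A := Algebra.subset_adjoin rfl
  let I : Ideal A := Ideal.span {⟨x⁻¹, hx⟩}
  have hI : I ≠ ⊤ := by
    intro h
    rw [Ideal.eq_top_iff_one, Ideal.mem_span_singleton'] at h
    obtain ⟨⟨a, ha⟩, h⟩ := h
    have h' : a * x⁻¹ = 1 := congrArg Subtype.val h
    obtain ⟨p, rfl⟩ : ∃ p : K[X], aeval x⁻¹ p = a := by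
      have ha' : a ∈ Algebra.adjoin K {x⁻¹} := ha
      rwa [Algebra.adjoin_singleton_eq_range_aeval] at ha'
    have halg : IsAlgebraic K x⁻¹ := by
      refine ⟨p * X - 1, fun h0 => ?_, by simp [h']⟩
      have := congrArg (eval 0) h0
      simp at this
    exact hg.transcendental (by simpa using halg.inv)
  obtain ⟨V, hV, hn⟩ := Ideal.image_subset_nonunits_valuationSubring I hI
  have hxV : x ∉ V := by
    have : x⁻¹ ∈ V.nonunits := hn ⟨⟨x⁻¹, hx⟩, Ideal.mem_span_singleton_self _, rfl⟩
    exact (V.inv_mem_nonunits_iff.1 this).resolve_left hg.x_ne_zero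
  exact ⟨⟨V, fun c => hV ((Algebra.adjoin K {x⁻¹}).algebraMap_mem c),
    fun h => hxV (h ▸ ValuationSubring.mem_top x)⟩, hxV⟩

theorem evalPair_hermitianPolynomial : evalPair K x y (hermitianPolynomial q K) = 0 := by
  rw [hermitianPolynomial, map_sub, map_add, map_pow, evalPair_X, evalPair_C, map_pow, aeval_X,
    hg.eq, sub_self]

/-- A non-zero remainder modulo the Hermitian polynomial has degree less than `q`, hence a leading
term at infinity, and cannot evaluate to zero. -/
theorem evalPair_eq_zero_iff {B : K[X][X]} :
    evalPair K x y B = 0 ↔ hermitianPolynomial q K ∣ B := by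
  have hm := monic_hermitianPolynomial (K := K) hg.two_lt
  have hq := hg.two_lt
  constructor
  · intro h
    rw [← modByMonic_eq_zero_iff_dvd hm]
    by_contra h0
    have hd : (B %ₘ hermitianPolynomial q K).natDegree < q := by
      have h1 := natDegree_modByMonic_lt B hm fun e => by
        have := natDegree_hermitianPolynomial (K := K) hg.two_lt
        rw [e, natDegree_one] at this
        omega
      rwa [natDegree_hermitianPolynomial hg.two_lt] at h1
    obtain ⟨n, c, hl, -⟩ := hg.exists_hasLeadingTerm_evalPair h0 hd
    refine hl.ne_zero hg.placesAtInfinity_nonempty hg.div_ne_zero ?_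
    rw [modByMonic_eq_sub_mul_div B, map_sub, map_mul, h, hg.evalPair_hermitianPolynomial]
    simp
  · rintro ⟨E, rfl⟩
    rw [map_mul, hg.evalPair_hermitianPolynomial, zero_mul]

theorem exists_natDegree_lt (B : K[X][X]) :
    ∃ E : K[X][X], E.natDegree < q ∧ evalPair K x y E = evalPair K x y B := by
  have hq := hg.two_lt
  have hm := monic_hermitianPolynomial (K := K) hq
  refine ⟨B %ₘ hermitianPolynomial q K, ?_, ?_⟩
  · have h1 := natDegree_modByMonic_lt B hm fun e => by
      have := natDegree_hermitianPolynomial (K := K) hq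
      rw [e, natDegree_one] at this
      omega
    rwa [natDegree_hermitianPolynomial hq] at h1
  · rw [modByMonic_eq_sub_mul_div B, map_sub, map_mul, hg.evalPair_hermitianPolynomial,
      zero_mul, sub_zero]

theorem aeval_ne_zero {p : K[X]} (hp : p ≠ 0) : aeval x p ≠ 0 :=
  fun h => hg.transcendental ⟨p, hp, h⟩

/-- `K[x, y]` is a domain integral over `K[x]`, so each non-zero element divides a non-zero
polynomial in `x`. -/
theorem exists_mul_evalPair_eq_aeval {B : K[X][X]} (hB : evalPair K x y B ≠ 0) :
    ∃ (E : K[X][X]) (r : K[X]), r ≠ 0 ∧ evalPair K x y B * evalPair K x y E = aeval x r := by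
  have hm := monic_hermitianPolynomial (K := K) hg.two_lt
  let A := AdjoinRoot (hermitianPolynomial q K)
  let f : A →+* H := AdjoinRoot.lift (aeval x : K[X] →ₐ[K] H).toRingHom y
    hg.evalPair_hermitianPolynomial
  have hfmk : ∀ E, f (AdjoinRoot.mk _ E) = evalPair K x y E := fun E => AdjoinRoot.lift_mk _ _
  have hf : Function.Injective f := by
    rw [injective_iff_map_eq_zero]
    intro a ha
    obtain ⟨E, rfl⟩ := AdjoinRoot.mk_surjective a
    rw [hfmk, hg.evalPair_eq_zero_iff] at ha
    exact AdjoinRoot.mk_eq_zero.2 ha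
  have : IsDomain A := hf.isDomain f
  have : Module.Finite K[X] A := hm.finite_adjoinRoot
  have hB' : AdjoinRoot.mk (hermitianPolynomial q K) B ∈ nonZeroDivisors A := by
    refine mem_nonZeroDivisors_of_ne_zero fun h => hB ?_
    rw [← hfmk, h, _root_.map_zero]
  have halg : IsAlgebraic K[X] (AdjoinRoot.mk (hermitianPolynomial q K) B) :=
    (Algebra.IsIntegral.isIntegral (R := K[X]) _).isAlgebraic
  obtain ⟨r, hr, a, ha⟩ := halg.exists_nonzero_dvd hB'
  obtain ⟨E, rfl⟩ := AdjoinRoot.mk_surjective a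
  refine ⟨E, r, hr, ?_⟩
  have h2 := congrArg f ha
  rw [map_mul, hfmk, hfmk] at h2
  rw [← h2, ← evalPair_C (K := K) x y, ← hfmk]
  rfl

theorem exists_aeval_mul_eq_evalPair (h : H) :
    ∃ (d : K[X]) (B : K[X][X]), d ≠ 0 ∧ aeval x d * h = evalPair K x y B := by
  have hh : h ∈ IntermediateField.adjoin K {x, y} := hg.adjoin_eq_top ▸ IntermediateField.mem_top
  induction hh using IntermediateField.adjoin_induction with
  | mem z hz =>
    rcases hz with rfl | rfl
    · exact ⟨1, C X, one_ne_zero, by rw [evalPair_C]; simp⟩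
    · exact ⟨1, X, one_ne_zero, by rw [evalPair_X]; simp⟩
  | algebraMap c => exact ⟨1, C (C c), one_ne_zero, by rw [evalPair_C]; simp⟩
  | add h h' _ _ ih ih' =>
    obtain ⟨d, B, hd, e⟩ := ih
    obtain ⟨d', B', hd', e'⟩ := ih'
    refine ⟨d * d', C d' * B + C d * B', mul_ne_zero hd hd', ?_⟩
    rw [map_add, map_mul, map_mul, map_mul, evalPair_C, evalPair_C, ← e, ← e']
    ring
  | inv h _ ih =>
    obtain ⟨d, B, hd, e⟩ := ih
    by_cases h0 : h = 0
    · exact ⟨1, 0, one_ne_zero, by simp [h0]⟩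
    have hB : evalPair K x y B ≠ 0 := by
      rw [← e]
      exact mul_ne_zero (hg.aeval_ne_zero hd) h0
    obtain ⟨E, r, hr, he⟩ := hg.exists_mul_evalPair_eq_aeval hB
    refine ⟨r, C d * E, hr, ?_⟩
    rw [map_mul, evalPair_C, ← he, ← e]
    field_simp
  | mul h h' _ _ ih ih' =>
    obtain ⟨d, B, hd, e⟩ := ih
    obtain ⟨d', B', hd', e'⟩ := ih'
    refine ⟨d * d', B * B', mul_ne_zero hd hd', ?_⟩
    rw [map_mul, map_mul, ← e, ← e']
    ring

theorem exists_hasLeadingTerm {h : H} (h0 : h ≠ 0) :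
    ∃ n c, HasLeadingTerm (placesAtInfinity K x) (x / y) h n c := by
  obtain ⟨d, B, hd, e⟩ := hg.exists_aeval_mul_eq_evalPair h
  obtain ⟨E, hE, hEB⟩ := hg.exists_natDegree_lt B
  have hE0 : E ≠ 0 := by
    rintro rfl
    rw [_root_.map_zero, ← e, zero_eq_mul] at hEB
    exact hEB.elim (hg.aeval_ne_zero hd) h0
  obtain ⟨n, c, hl, -⟩ := hg.exists_hasLeadingTerm_evalPair hE0 hE
  have := ((hg.hasLeadingTerm_aeval hd).inv hg.div_ne_zero).mul hl hg.div_ne_zero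
  rw [hEB, ← e, inv_mul_cancel_left₀ (hg.aeval_ne_zero hd)] at this
  exact ⟨_, _, this⟩

/-- An integral equation for `z` shows that `p` divides a power of `p * z = B(x, y)`. Modulo `p` the
Hermitian polynomial then divides a power of `B`. Being separable, it divides `B` itself, whose
degree is less than `q`, so `B` vanishes modulo `p` and `p` can be cancelled. The ring `s` is only
assumed equal to the range so that it can later be a `Subring.closure`. -/
theorem mem_range_of_prime_mul {s : Subring H} (hs : s = (evalPair K x y).range) {p : K[X]}
    (hp : Prime p) {z : H} (hz : IsIntegral s z) (hpz : aeval x p * z ∈ (evalPair K x y).range) :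
    z ∈ (evalPair K x y).range := by
  obtain ⟨B₀, hB₀⟩ := hpz
  obtain ⟨B, hB, hBe⟩ := hg.exists_natDegree_lt B₀
  rw [hB₀] at hBe
  obtain ⟨P, hPm, hPz⟩ := hz
  have h1 : aeval x p ∈ s := hs ▸ ⟨C p, evalPair_C x y p⟩
  have h2 : aeval x p * z ∈ s := hs ▸ ⟨B, hBe⟩
  obtain ⟨⟨a, ha⟩, hdvd⟩ := dvd_pow_natDegree_of_eval₂_eq_zero (f := algebraMap s H)
    Subtype.val_injective hPm ⟨_, h1⟩ ⟨_, h2⟩ z hPz rfl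
  have ha' : a ∈ (evalPair K x y).range := hs ▸ ha
  obtain ⟨E, rfl⟩ := ha'
  have hdvd' : (aeval x p * z) ^ P.natDegree = aeval x p * evalPair K x y E :=
    congrArg Subtype.val hdvd
  have hF : hermitianPolynomial q K ∣ B ^ P.natDegree - C p * E := by
    rw [← hg.evalPair_eq_zero_iff, map_sub, map_pow, map_mul, hBe, evalPair_C, hdvd', sub_self]
  have : (Ideal.span {p}).IsMaximal :=
    PrincipalIdealRing.isMaximal_of_irreducible hp.irreducible
  let k := K[X] ⧸ Ideal.span {p}
  let : Field k := Ideal.Quotient.field _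
  let φ : K[X] →+* k := Ideal.Quotient.mk _
  have hφp : φ p = 0 := Ideal.Quotient.eq_zero_iff_mem.2 (Ideal.mem_span_singleton_self p)
  have hF2 : (hermitianPolynomial q K).map φ ∣ B.map φ ^ P.natDegree := by
    have := Polynomial.map_dvd φ hF
    rwa [Polynomial.map_sub, Polynomial.map_mul, map_C, hφp, C_0, zero_mul, sub_zero,
      Polynomial.map_pow] at this
  have hsep : ((hermitianPolynomial q K).map φ).Separable :=
    separable_map_hermitianPolynomial hg.cast_eq_zero φ
  have hF3 := hsep.squarefree.isRadical _ _ hF2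
  have hm := monic_hermitianPolynomial (K := K) hg.two_lt
  have hB0 : B.map φ = 0 := by
    refine eq_zero_of_dvd_of_natDegree_lt hF3 ?_
    rw [hm.natDegree_map, natDegree_hermitianPolynomial hg.two_lt]
    exact natDegree_map_le.trans_lt hB
  have hpB : C p ∣ B := by
    rw [C_dvd_iff_dvd_coeff]
    intro i
    have := congrArg (coeff · i) hB0
    simp only [coeff_map, coeff_zero] at this
    exact Ideal.mem_span_singleton.1 (Ideal.Quotient.eq_zero_iff_mem.1 this)
  obtain ⟨G, rfl⟩ := hpB
  rw [map_mul, evalPair_C] at hBe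
  exact ⟨G, mul_left_cancel₀ (hg.aeval_ne_zero hp.ne_zero) hBe⟩

/-- The ring `K[x, y]` is integrally closed. -/
theorem mem_range_of_isIntegral {s : Subring H} (hs : s = (evalPair K x y).range) {z : H}
    (hz : IsIntegral s z) : z ∈ (evalPair K x y).range := by
  -- The denominator in `K[x]` is removed one prime factor at a time.
  have key : ∀ d : K[X], ∀ z : H, IsIntegral s z → d ≠ 0 →
      aeval x d * z ∈ (evalPair K x y).range → z ∈ (evalPair K x y).range := by
    intro d
    induction d using UniqueFactorizationMonoid.induction_on_prime with
    | h₁ => exact fun z _ h => absurd rfl h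
    | h₂ u hu =>
      intro z _ _ h
      obtain ⟨c, hc, rfl⟩ := Polynomial.isUnit_iff.1 hu
      have : z = evalPair K x y (C (C c⁻¹)) * (aeval x (C c) * z) := by
        rw [evalPair_C, aeval_C, aeval_C, ← mul_assoc, ← map_mul, inv_mul_cancel₀ hc.ne_zero,
          _root_.map_one, one_mul]
      rw [this]
      exact mul_mem ⟨_, rfl⟩ h
    | h₃ a p ha hp ih =>
      intro z hz _ h
      refine ih z hz ha (hg.mem_range_of_prime_mul hs hp ?_ ?_)
      · refine IsIntegral.mul ?_ hz
        have : aeval x a ∈ s := hs ▸ ⟨C a, evalPair_C x y a⟩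
        exact isIntegral_algebraMap (R := s) (x := ⟨_, this⟩)
      · rwa [← mul_assoc, ← map_mul]
  obtain ⟨d, B, hd, e⟩ := hg.exists_aeval_mul_eq_evalPair z
  exact key d z hz hd ⟨B, e.symm⟩

/-- A function whose only poles are poles of `x` is a polynomial in `x` and `y`. -/
theorem exists_evalPair_eq {z : H} (hz : ∀ P : Place K H, x ∈ P.ring → z ∈ P.ring) :
    ∃ B : K[X][X], B.natDegree < q ∧ evalPair K x y B = z := by
  have hint : z ∈ (integralClosure (Subring.closure ((evalPair K x y).range : Set H))
      H).toSubring := by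
    -- The integral closure is the intersection of the valuation rings containing `K[x, y]`; apart
    -- from the whole field, these are places where `x` is regular.
    rw [← iInf_valuationSubring_superset, Subring.mem_iInf]
    rintro ⟨V, hV⟩
    by_cases h : V = ⊤
    · subst h
      exact ValuationSubring.mem_top z
    · refine hz ⟨V, fun c => hV ⟨C (C c), ?_⟩, h⟩ (hV ⟨C X, ?_⟩)
      · rw [evalPair_C, aeval_C]
      · rw [evalPair_C, aeval_X]
  obtain ⟨B, rfl⟩ := hg.mem_range_of_isIntegral (Subring.closure_eq _) hint
  exact hg.exists_natDegree_lt B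

end HermitianGenerators

/-! ### Affine rational points -/

/-- The places at which `x - a` has a zero. -/
def placesOver {K H : Type*} [Field K] [Field H] [Algebra K H] (x : H) (a : K) :
    Set (Place K H) :=
  {P | P.ring.valuation (x - algebraMap K H a) < 1}

section placesOver

variable {K H : Type*} [Field K] [Field H] [Algebra K H] {x y : H} {a b : K}

theorem mem_ring_of_mem_placesOver {P : Place K H} (hP : P ∈ placesOver x a) : x ∈ P.ring := by
  have h : x - algebraMap K H a ∈ P.ring := (P.ring.valuation_le_one_iff _).1 (le_of_lt hP)
  simpa using add_mem h (P.algebraMap_mem a)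

theorem eq_of_mem_placesOver {P : Place K H} (ha : P ∈ placesOver x a) (hb : P ∈ placesOver x b) :
    a = b := by
  refine sub_eq_zero.1 (P.eq_zero_of_valuation_algebraMap_lt_one ?_)
  have := Valuation.map_sub_lt _ (show P.ring.valuation _ < 1 from hb) ha
  rwa [sub_sub_sub_cancel_left, ← map_sub] at this

theorem valuation_aeval_sub_lt_one {P : Place K H} (hP : P ∈ placesOver x a) (p : K[X]) :
    P.ring.valuation (aeval x p - algebraMap K H (p.eval a)) < 1 := by
  obtain ⟨r, hr⟩ := X_sub_C_dvd_sub_C_eval (p := p) (a := a)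
  have e : aeval x p - algebraMap K H (p.eval a) = (x - algebraMap K H a) * aeval x r := by
    have := congrArg (aeval x) hr
    simpa using this
  rw [e, map_mul]
  refine lt_of_le_of_lt (mul_le_of_le_one_right' ?_) hP
  exact (P.ring.valuation_le_one_iff _).2 (aeval_mem_place x (mem_ring_of_mem_placesOver hP) r)

/-- Write `p = (X - a) ^ m * r` with `r(a) ≠ 0`. The exponent `m` is the same at every place over
`a`, so zeros and poles of functions in `K(x)` spread over the fibre. -/
theorem hasLeadingTerm_placesOver (hx : Transcendental K x) {p : K[X]} (hp : p ≠ 0) (a : K) :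
    ∃ (n : ℕ) (c : K), HasLeadingTerm (placesOver x a) (x - algebraMap K H a) (aeval x p) n c := by
  have ht : x - algebraMap K H a ≠ 0 := by
    intro h
    rw [sub_eq_zero] at h
    exact hx (h ▸ isAlgebraic_algebraMap a)
  obtain ⟨r, hr, hnd⟩ := exists_eq_pow_rootMultiplicity_mul_and_not_dvd p hp a
  have hr0 : r.eval a ≠ 0 := fun h => hnd (dvd_iff_isRoot.2 h)
  have h1 : HasLeadingTerm (placesOver x a) (x - algebraMap K H a) (aeval x r) 0 (r.eval a) :=
    ⟨hr0, fun P hP => by simpa using valuation_aeval_sub_lt_one hP r⟩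
  have h2 := ((HasLeadingTerm.self (S := placesOver x a) (K := K) ht).pow ht
    (p.rootMultiplicity a)).mul h1 ht
  refine ⟨p.rootMultiplicity a, 1 ^ p.rootMultiplicity a * r.eval a, ?_⟩
  convert h2 using 1
  · conv_lhs => rw [hr]
    simp
  · simp

theorem exists_mem_placesOver {P : Place K H} (hP : P.degree = 1) (hx : x ∈ P.ring) :
    ∃ a : K, P ∈ placesOver x a :=
  Place.degree_eq_one_iff.1 hP x hx

theorem evalEval_eq_zero_of_valuation_lt_one {P : Place K H} (ha : P ∈ placesOver x a)
    (hb : P ∈ placesOver y b) {p : K[X]} {c : K}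
    (h : P.ring.valuation (aeval x p + algebraMap K H c * y) < 1) : p.eval a + c * b = 0 := by
  refine P.eq_zero_of_valuation_algebraMap_lt_one ?_
  have h1 : P.ring.valuation (algebraMap K H c * (y - algebraMap K H b)) < 1 := by
    rw [map_mul]
    exact lt_of_le_of_lt (mul_le_of_le_one_left' (P.valuation_algebraMap_le_one c)) hb
  have h2 := Valuation.map_sub_lt _ (Valuation.map_sub_lt _ h (valuation_aeval_sub_lt_one ha p)) h1
  convert h2 using 2
  rw [map_add, map_mul]
  ring

/-- A polynomial in two variables minus its value at a point lies in the ideal of the point. -/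
theorem exists_eq_evalEval_add (B : K[X][X]) (a b : K) : ∃ R E : K[X][X],
    B = C (C (B.evalEval a b)) + C (X - C a) * R + (X - C (C b)) * E := by
  obtain ⟨E, hE⟩ := X_sub_C_dvd_sub_C_eval (p := B) (a := C b)
  obtain ⟨r, hr⟩ := X_sub_C_dvd_sub_C_eval (p := B.eval (C b)) (a := a)
  refine ⟨C r, E, ?_⟩
  rw [← hE, ← C_mul, ← hr, evalEval, C_sub]
  ring

end placesOver

namespace HermitianGenerators

variable {q : ℕ} {K H : Type*} [Field K] [Field H] [Algebra K H] {x y : H}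
  (hg : HermitianGenerators q K x y) {a b : K}

include hg

theorem sub_algebraMap_ne_zero (a : K) : x - algebraMap K H a ≠ 0 := by
  intro h
  rw [sub_eq_zero] at h
  exact hg.transcendental (h ▸ isAlgebraic_algebraMap a)

/-- The ideal of the point `(a, b)` is proper: otherwise the Hermitian polynomial would divide some
`B - 1` with `B(a, b) = 0`, and evaluating at `(a, b)` gives `0 = -1`. -/
theorem placesOver_inter_nonempty (hab : b ^ q + b = a ^ (q + 1)) :
    (placesOver x a ∩ placesOver y b).Nonempty := by
  let f := (evalPair K x y).rangeRestrict
  have hf : Function.Surjective f := (evalPair K x y).rangeRestrict_surjective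
  let I : Ideal (evalPair K x y).range := (RingHom.ker (evalEvalRingHom a b)).map f
  have hI : I ≠ ⊤ := by
    intro h
    rw [Ideal.eq_top_iff_one, Ideal.mem_map_iff_of_surjective f hf] at h
    obtain ⟨B, hB, hB1⟩ := h
    have h1 : evalPair K x y B = 1 := congrArg Subtype.val hB1
    have h2 : hermitianPolynomial q K ∣ B - 1 := by
      rw [← hg.evalPair_eq_zero_iff, map_sub, h1, _root_.map_one, sub_self]
    have h3 := _root_.map_dvd (evalEvalRingHom a b) h2
    have h4 : evalEvalRingHom a b (hermitianPolynomial q K) = 0 := by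
      simp [hermitianPolynomial, hab]
    rw [h4, map_sub, RingHom.mem_ker.1 hB, zero_dvd_iff, _root_.map_one] at h3
    simp at h3
  obtain ⟨V, hV, hn⟩ := Ideal.image_subset_nonunits_valuationSubring I hI
  have key : ∀ B : K[X][X], B.evalEval a b = 0 → V.valuation (evalPair K x y B) < 1 := fun B hB =>
    hn ⟨f B, Ideal.mem_map_of_mem f hB, rfl⟩
  have hx : V.valuation (x - algebraMap K H a) < 1 := by
    have := key (C (X - C a)) (by simp [evalEval])
    rwa [evalPair_C, map_sub, aeval_X, aeval_C] at this
  have hy : V.valuation (y - algebraMap K H b) < 1 := by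
    have := key (X - C (C b)) (by simp [evalEval])
    rwa [map_sub, evalPair_X, evalPair_C, aeval_C] at this
  refine ⟨⟨V, fun c => hV ⟨C (C c), by rw [evalPair_C, aeval_C]⟩, fun h => ?_⟩, hx, hy⟩
  have h1 : (x - algebraMap K H a)⁻¹ ∉ V :=
    (V.mem_nonunits_iff_or.1 (V.mem_nonunits_iff.2 hx)).resolve_left (hg.sub_algebraMap_ne_zero a)
  exact h1 (h ▸ ValuationSubring.mem_top _)

/-- Subtracting the equations of `(x, y)` and `(a, b)` gives `(y - b) ^ q + (y - b) = x ^ (q + 1) -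
a ^ (q + 1)`. The first factor on the left is a unit at the point, so `y - b` is locally a multiple
of `x - a`. -/
theorem unit_mul_sub_eq (hab : b ^ q + b = a ^ (q + 1)) : ∃ w : K[X],
    ((y - algebraMap K H b) ^ (q - 1) + 1) * (y - algebraMap K H b) =
      (x - algebraMap K H a) * aeval x w := by
  have hq := hg.two_lt
  obtain ⟨w, hw⟩ := sub_dvd_pow_sub_pow (X : K[X]) (C a) (q + 1)
  refine ⟨w, ?_⟩
  have h1 := congrArg (aeval x) hw
  simp only [map_sub, map_pow, map_mul, aeval_X, aeval_C] at h1
  rw [← h1, add_mul, one_mul, pow_sub_one_mul (by omega), hg.sub_pow, ← hg.eq, ← map_pow, ← map_pow,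
    ← hab, map_add]
  ring

/-- If the cofactor `E` is non-zero at `(a, b)`, its value is the leading coefficient. Otherwise `E`
lies in the ideal of `x - a` and `y - b`, and one more unit factor allows another `x - a` to be
extracted. -/
theorem hasLeadingTerm_or_pow_dvd (hab : b ^ q + b = a ^ (q + 1)) (B : K[X][X]) (n : ℕ) :
    (∃ m c, HasLeadingTerm (placesOver x a ∩ placesOver y b) (x - algebraMap K H a)
      (evalPair K x y B) m c) ∨
    ∃ (e : ℕ) (E : K[X][X]), ((y - algebraMap K H b) ^ (q - 1) + 1) ^ e * evalPair K x y B =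
      (x - algebraMap K H a) ^ n * evalPair K x y E := by
  have hq := hg.two_lt
  have ht := hg.sub_algebraMap_ne_zero a
  have hu : HasLeadingTerm (placesOver x a ∩ placesOver y b) (x - algebraMap K H a)
      ((y - algebraMap K H b) ^ (q - 1) + 1) 0 (1 : K) := by
    refine ⟨one_ne_zero, fun P hP => ?_⟩
    simpa using pow_lt_one₀ zero_le hP.2 (by omega)
  induction n with
  | zero => exact .inr ⟨0, B, by simp⟩
  | succ n ih =>
    rcases ih with h | ⟨e, E, hE⟩
    · exact .inl h
    obtain ⟨R, G, hRG⟩ := exists_eq_evalEval_add E a b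
    have hev : evalPair K x y E = algebraMap K H (E.evalEval a b) +
        (x - algebraMap K H a) * evalPair K x y R + (y - algebraMap K H b) * evalPair K x y G := by
      conv_lhs => rw [hRG]
      simp only [map_add, map_mul, map_sub, evalPair_C, evalPair_X, aeval_X, aeval_C]
    by_cases h0 : E.evalEval a b = 0
    · obtain ⟨w, hw⟩ := hg.unit_mul_sub_eq hab
      refine .inr ⟨e + 1, ((X - C (C b)) ^ (q - 1) + 1) * R + C w * G, ?_⟩
      simp only [map_add, map_mul, map_sub, map_pow, evalPair_C, evalPair_X, aeval_C, _root_.map_one]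
      rw [pow_succ', mul_assoc, hE, hev, h0, _root_.map_zero]
      linear_combination (x - algebraMap K H a) ^ n * evalPair K x y G * hw
    · left
      have hE0 : HasLeadingTerm (placesOver x a ∩ placesOver y b) (x - algebraMap K H a)
          (evalPair K x y E) 0 (E.evalEval a b) := by
        refine ⟨h0, fun P hP => ?_⟩
        have hx := mem_ring_of_mem_placesOver hP.1
        have hy := mem_ring_of_mem_placesOver hP.2
        rw [hev, zpow_zero, zpow_zero, mul_one, add_assoc, add_sub_cancel_left]
        refine Valuation.map_add_lt _ ?_ ?_ <;> rw [map_mul]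
        · exact lt_of_le_of_lt (mul_le_of_le_one_right' ((P.ring.valuation_le_one_iff _).2
            (evalPair_mem_place x y hx hy R))) hP.1
        · exact lt_of_le_of_lt (mul_le_of_le_one_right' ((P.ring.valuation_le_one_iff _).2
            (evalPair_mem_place x y hx hy G))) hP.2
      have hl := (((HasLeadingTerm.self ht).pow ht n).mul hE0 ht).mul ((hu.pow ht e).inv ht) ht
      rw [← hE] at hl
      by_cases hu0 : (y - algebraMap K H b) ^ (q - 1) + 1 = 0
      · exact absurd hu0 (hu.ne_zero (hg.placesOver_inter_nonempty hab) ht)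
      rw [mul_assoc, mul_comm, mul_assoc, inv_mul_cancel₀ (pow_ne_zero _ hu0), mul_one] at hl
      exact ⟨_, _, hl⟩

theorem exists_hasLeadingTerm_point (hab : b ^ q + b = a ^ (q + 1)) {h : H} (h0 : h ≠ 0) :
    ∃ m c, HasLeadingTerm (placesOver x a ∩ placesOver y b) (x - algebraMap K H a) h m c := by
  have ht := hg.sub_algebraMap_ne_zero a
  obtain ⟨d, B, hd, e⟩ := hg.exists_aeval_mul_eq_evalPair h
  obtain ⟨n, c, hl⟩ := hasLeadingTerm_placesOver hg.transcendental hd a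
  have hl' := hl.mono (T := placesOver x a ∩ placesOver y b) Set.inter_subset_left
  suffices hB : ∃ m c, HasLeadingTerm (placesOver x a ∩ placesOver y b) (x - algebraMap K H a)
      (evalPair K x y B) m c by
    obtain ⟨m, c', hB⟩ := hB
    have := (hl'.inv ht).mul hB ht
    rw [← e, inv_mul_cancel_left₀ (hg.aeval_ne_zero hd)] at this
    exact ⟨_, _, this⟩
  have hB0 : evalPair K x y B ≠ 0 := by
    rw [← e]
    exact mul_ne_zero (hg.aeval_ne_zero hd) h0
  -- `B` divides a polynomial `r(x)` of order `k` in `x - a`, so divisibility by `(x - a) ^ (k + 1)`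
  -- up to units is impossible.
  obtain ⟨E, r, hr, hE⟩ := hg.exists_mul_evalPair_eq_aeval hB0
  obtain ⟨k, c', hk⟩ := hasLeadingTerm_placesOver hg.transcendental hr a
  refine (hg.hasLeadingTerm_or_pow_dvd hab B (k + 1)).resolve_right ?_
  rintro ⟨j, G, hG⟩
  obtain ⟨P, hP⟩ := hg.placesOver_inter_nonempty hab
  have hx := mem_ring_of_mem_placesOver hP.1
  have hy := mem_ring_of_mem_placesOver hP.2
  have hle : ∀ E : K[X][X], P.ring.valuation (evalPair K x y E) ≤ 1 := fun E =>
    (P.ring.valuation_le_one_iff _).2 (evalPair_mem_place x y hx hy E)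
  have hq := hg.two_lt
  have hu : P.ring.valuation ((y - algebraMap K H b) ^ (q - 1) + 1) = 1 := by
    rw [add_comm]
    refine Valuation.map_one_add_of_lt _ ?_
    rw [map_pow]
    exact pow_lt_one₀ zero_le hP.2 (by omega)
  have h1 : P.ring.valuation (evalPair K x y B) ≤
      P.ring.valuation (x - algebraMap K H a) ^ (k + 1) := by
    have := congrArg P.ring.valuation hG
    rw [map_mul, map_pow, hu, one_pow, one_mul, map_mul, map_pow] at this
    rw [this]
    exact mul_le_of_le_one_right' (hle G)
  have h2 : P.ring.valuation (x - algebraMap K H a) ^ k ≤ P.ring.valuation (evalPair K x y B) := by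
    rw [← zpow_natCast, ← hk.valuation_eq hP.1, ← hE, map_mul]
    exact mul_le_of_le_one_right' (hle E)
  refine (h2.trans h1).not_gt (pow_lt_pow_right_of_lt_one₀ ?_ hP.1 k.lt_succ_self)
  exact (Valuation.pos_iff _).2 ht

theorem degree_eq_one_of_mem_point (hab : b ^ q + b = a ^ (q + 1)) {P : Place K H}
    (hP : P ∈ placesOver x a ∩ placesOver y b) : P.degree = 1 :=
  degree_eq_one_of_hasLeadingTerm hP (hg.sub_algebraMap_ne_zero a) hP.1 fun _ h0 =>
    hg.exists_hasLeadingTerm_point hab h0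

theorem degree_eq_one_of_mem_placesAtInfinity {P : Place K H} (hP : P ∈ placesAtInfinity K x) :
    P.degree = 1 :=
  degree_eq_one_of_hasLeadingTerm hP hg.div_ne_zero (hg.valuation_div_lt_one hP) fun _ h0 =>
    hg.exists_hasLeadingTerm h0

theorem placesAtInfinity_subsingleton : (placesAtInfinity K x).Subsingleton :=
  subsingleton_of_hasLeadingTerm hg.div_ne_zero (fun _ hP => hg.valuation_div_lt_one hP)
    fun _ h0 => hg.exists_hasLeadingTerm h0

/-! ### The spaces `L(m P∞)` -/

theorem isOrd_iff {P : Place K H} (hP : P ∈ placesAtInfinity K x) {f : H} {n : ℤ} :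
    P.IsOrd f n ↔ P.ring.valuation f = P.ring.valuation (x / y) ^ n := by
  obtain ⟨s, hs, hs'⟩ := maximalIdeal_eq_span_of_hasLeadingTerm hP hg.div_ne_zero
    (hg.valuation_div_lt_one hP) fun _ h0 => hg.exists_hasLeadingTerm h0
  rw [← hs]
  exact ⟨fun h => h.valuation_eq hs', fun h => ⟨s, hs', h⟩⟩

theorem exists_coeff_weight_le {z : H} (hz : ∀ P : Place K H, x ∈ P.ring → z ∈ P.ring)
    {P : Place K H} (hP : P ∈ placesAtInfinity K x) {m : ℕ}
    (hv : P.ring.valuation z ≤ P.ring.valuation (x / y) ^ (-m : ℤ)) :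
    ∃ B : K[X][X], evalPair K x y B = z ∧
      ∀ j, B.coeff j ≠ 0 → q * (B.coeff j).natDegree + (q + 1) * j ≤ m := by
  obtain ⟨B, hB, rfl⟩ := hg.exists_evalPair_eq hz
  refine ⟨B, rfl, ?_⟩
  by_cases hB0 : B = 0
  · simp [hB0]
  obtain ⟨n, c, hl, hn⟩ := hg.exists_hasLeadingTerm_evalPair hB0 hB
  rw [hl.valuation_eq hP] at hv
  have := (P.strictAnti_zpow_valuation hg.div_ne_zero (hg.valuation_div_lt_one hP)).le_iff_ge.1 hv
  exact fun j hj => (hn j hj).trans (by omega)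

/-- Non-constant monomials have pole order at least `q > 2`. -/
theorem mem_range_algebraMap {z : H} (hz : ∀ P : Place K H, x ∈ P.ring → z ∈ P.ring)
    {P : Place K H} (hP : P ∈ placesAtInfinity K x)
    (hv : P.ring.valuation z ≤ P.ring.valuation (x / y) ^ (-2 : ℤ)) :
    z ∈ Set.range (algebraMap K H) := by
  have hq := hg.two_lt
  obtain ⟨B, rfl, h⟩ := hg.exists_coeff_weight_le (m := 2) hz hP hv
  have h1 : B.natDegree = 0 := by
    by_contra h0
    have hlc : B.coeff B.natDegree ≠ 0 := by
      rw [coeff_natDegree, leadingCoeff_ne_zero]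
      rintro rfl
      exact h0 natDegree_zero
    have := h _ hlc
    have : q + 1 ≤ (q + 1) * B.natDegree := Nat.le_mul_of_pos_right _ (by omega)
    omega
  obtain ⟨p, rfl⟩ := natDegree_eq_zero.1 h1
  have h2 : p.natDegree = 0 := by
    by_contra h0
    have := h 0 (by
      rw [coeff_C_zero]
      rintro rfl
      exact h0 natDegree_zero)
    rw [coeff_C_zero] at this
    have : q ≤ q * p.natDegree := Nat.le_mul_of_pos_right _ (by omega)
    omega
  obtain ⟨c, rfl⟩ := natDegree_eq_zero.1 h2
  exact ⟨c, by rw [evalPair_C, aeval_C]⟩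

/-- The monomials `x * y`, `y ^ 2` and `x ^ 3` have pole orders `2q + 1`, `2q + 2` and `3q`, all
above `2q`. -/
theorem exists_eq_aeval_add {z : H} (hz : ∀ P : Place K H, x ∈ P.ring → z ∈ P.ring)
    {P : Place K H} (hP : P ∈ placesAtInfinity K x)
    (hv : P.ring.valuation z ≤ P.ring.valuation (x / y) ^ (-(2 * q) : ℤ)) :
    ∃ (p : K[X]) (c : K), p.natDegree ≤ 2 ∧ z = aeval x p + algebraMap K H c * y := by
  have hq := hg.two_lt
  obtain ⟨B, rfl, h⟩ := hg.exists_coeff_weight_le (m := 2 * q) hz hP (by exact_mod_cast hv)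
  have h1 : B.natDegree ≤ 1 := by
    refine natDegree_le_iff_coeff_eq_zero.2 fun j hj => ?_
    by_contra h0
    have := h j h0
    have : (q + 1) * 2 ≤ (q + 1) * j := Nat.mul_le_mul_left _ hj
    omega
  obtain ⟨r, p, rfl⟩ := exists_eq_X_add_C_of_natDegree_le_one h1
  have hp : p.natDegree ≤ 2 := by
    by_contra! h0
    have := h 0 (by
      simp only [coeff_add, mul_coeff_zero, coeff_X_zero, mul_zero, coeff_C_zero, zero_add]
      rintro rfl
      simp at h0)
    simp only [coeff_add, mul_coeff_zero, coeff_X_zero, mul_zero, coeff_C_zero, zero_add] at this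
    have : q * 3 ≤ q * p.natDegree := Nat.mul_le_mul_left _ h0
    omega
  have hr : r.natDegree = 0 := by
    by_contra h0
    have hc : (C r * X + C p).coeff 1 = r := by
      rw [coeff_add, coeff_C_mul, coeff_X_one, mul_one, coeff_C_of_ne_zero one_ne_zero, add_zero]
    have := h 1 (by
      rw [hc]
      rintro rfl
      exact h0 natDegree_zero)
    rw [hc] at this
    have : q ≤ q * r.natDegree := Nat.le_mul_of_pos_right _ (by omega)
    omega
  obtain ⟨c, rfl⟩ := natDegree_eq_zero.1 hr
  refine ⟨p, c, hp, ?_⟩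
  rw [map_add, map_mul, evalPair_C, evalPair_C, evalPair_X, aeval_C, add_comm]

end HermitianGenerators

/-! ### Functions with at most two zeros -/

theorem FunctionFieldDivisor.Divisor.sum_posPart_le {K F : Type*} [Field K] [Field F] [Algebra K F]
    (D : Divisor K F) (s : Finset (Place K F)) :
    ∑ P ∈ s, max (D P) 0 ≤ ∑ P ∈ D.support, max (D P) 0 := by
  classical
  rw [Finset.sum_subset (s₁ := D.support) (s₂ := D.support ∪ s) Finset.subset_union_left]
  · exact Finset.sum_le_sum_of_subset_of_nonneg Finset.subset_union_right
      fun _ _ _ => le_max_right _ _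
  · intro P _ hP
    rw [Finsupp.notMem_support_iff.1 hP, max_self]

/-- The polynomial cancelling the zeros of order `D P` of a function at the places `P ∈ s` that lie
over `X = a P`. -/
noncomputable def clearingPolynomial {K F : Type*} [Field K] [Field F] [Algebra K F]
    (D : Divisor K F) (a : Place K F → K) (s : Finset (Place K F)) : K[X] :=
  ∏ P ∈ s, (X - C (a P)) ^ (D P).toNat

theorem eq_zero_of_eval_add_mul_eq_zero {K : Type*} [Field K] {p : K[X]} {c a b b' : K}
    (hb : b ≠ b') (h : p.eval a + c * b = 0) (h' : p.eval a + c * b' = 0) : c = 0 := by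
  have : c * (b - b') = 0 := by linear_combination h - h'
  exact (mul_eq_zero.1 this).resolve_right (sub_ne_zero.2 hb)

section clearingPolynomial

variable {K F : Type*} [Field K] [Field F] [Algebra K F] {D : Divisor K F} {a : Place K F → K}
  {s : Finset (Place K F)}

theorem monic_clearingPolynomial : (clearingPolynomial D a s).Monic :=
  monic_prod_of_monic _ _ fun _ _ => (monic_X_sub_C _).pow _

theorem natDegree_clearingPolynomial :
    (clearingPolynomial D a s).natDegree = ∑ P ∈ s, (D P).toNat := by
  rw [clearingPolynomial, natDegree_prod_of_monic _ _ fun _ _ => (monic_X_sub_C _).pow _]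
  exact Finset.sum_congr rfl fun P _ => by rw [natDegree_pow, natDegree_X_sub_C, mul_one]

theorem clearingPolynomial_eq_mul_erase [DecidableEq (Place K F)] {P : Place K F} (hP : P ∈ s) :
    clearingPolynomial D a s = (X - C (a P)) ^ (D P).toNat * clearingPolynomial D a (s.erase P) :=
  (Finset.mul_prod_erase _ _ hP).symm

/-- Multiplying by the clearing polynomial removes the poles of `f⁻¹` in `s`. -/
theorem inv_mul_clearingPolynomial_mem {f x : F} (hf : D.IsDivisorOf f) {Q : Place K F}
    (hx : x ∈ Q.ring) (ha : Q ∈ s → Q ∈ placesOver x (a Q)) (hQ : 0 < D Q → Q ∈ s) :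
    f⁻¹ * aeval x (clearingPolynomial D a s) ∈ Q.ring := by
  classical
  by_cases hQs : Q ∈ s
  · rw [clearingPolynomial_eq_mul_erase hQs, map_mul, ← mul_assoc]
    refine mul_mem ?_ (aeval_mem_place x hx _)
    obtain ⟨t, ht, h⟩ := hf.2 Q
    have ht0 : 0 < Q.ring.valuation (t : F) := (Valuation.pos_iff _).2 (Place.ne_zero_of_span ht)
    have hle := Place.valuation_le_of_span ht (ha hQs)
    rw [← Q.ring.valuation_le_one_iff, map_mul, map_inv₀, h, map_pow, map_pow, map_sub, aeval_X,
      aeval_C]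
    rw [inv_mul_le_iff₀ (zpow_pos ht0 _), mul_one]
    refine (pow_le_pow_left₀ zero_le hle _).trans ?_
    rw [← zpow_natCast]
    exact (Q.strictAnti_zpow_valuation (Place.ne_zero_of_span ht)
      (Place.valuation_lt_one_of_span ht)).antitone (Int.self_le_toNat _)
  · refine mul_mem ?_ (aeval_mem_place x hx _)
    rw [← Q.ring.valuation_le_one_iff, ← not_lt, (hf.2 Q).inv.one_lt_valuation_iff]
    intro h
    exact hQs (hQ (by omega))

end clearingPolynomial

namespace HermitianGenerators

variable {q : ℕ} {K H : Type*} [Field K] [Field H] [Algebra K H] {x y : H}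
  (hg : HermitianGenerators q K x y)

include hg

theorem valuation_inv_mul_aeval {f : H} {D : Divisor K H} (hf : D.IsDivisorOf f) {p : K[X]}
    (hp : p ≠ 0) {P : Place K H} (hP : P ∈ placesAtInfinity K x) :
    P.ring.valuation (f⁻¹ * aeval x p) =
      P.ring.valuation (x / y) ^ (-D P + -(q * p.natDegree : ℤ)) := by
  rw [map_mul, (hg.isOrd_iff hP).1 (hf.2 P).inv, (hg.hasLeadingTerm_aeval hp).valuation_eq hP,
    zpow_add₀ ((Valuation.ne_zero_iff _).2 hg.div_ne_zero)]

/-- If a function in `K(x)` has a pole over `x = a` then it has a pole at all places over `x = a`. -/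
theorem one_lt_valuation_of_mul_aeval_eq {g : H} (hg0 : g ≠ 0) {p r : K[X]} (hr : r ≠ 0)
    (h : g * aeval x r = aeval x p) {a : K} {P Q : Place K H} (hP : P ∈ placesOver x a)
    (hQ : Q ∈ placesOver x a) (hgP : 1 < P.ring.valuation g) : 1 < Q.ring.valuation g := by
  have ht := hg.sub_algebraMap_ne_zero a
  have hp : p ≠ 0 := by
    rintro rfl
    rw [_root_.map_zero] at h
    exact mul_ne_zero hg0 (hg.aeval_ne_zero hr) h
  obtain ⟨n, c, h1⟩ := hasLeadingTerm_placesOver hg.transcendental hp a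
  obtain ⟨n', c', h2⟩ := hasLeadingTerm_placesOver hg.transcendental hr a
  have h3 := h1.mul (h2.inv ht) ht
  rw [← h, mul_inv_cancel_right₀ (hg.aeval_ne_zero hr)] at h3
  rw [← not_le, h3.valuation_le_one_iff hP ht hP] at hgP
  rwa [← not_le, h3.valuation_le_one_iff hQ ht hQ]

/-- A function with few zeros has no zero outside of the poles of `x`, if its zeros are rational. -/
theorem not_pos_of_sum_posPart_le {f : H} {D : Divisor K H} (hf : D.IsDivisorOf f)
    (hdeg : ∀ P, 0 < D P → P.degree = 1) (hD : ∑ P ∈ D.support, max (D P) 0 ≤ 2)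
    {P : Place K H} (hx : x ∈ P.ring) : ¬ 0 < D P := by
  classical
  intro hDP
  have hq := hg.two_lt
  have hsel : ∀ Q : Place K H, ∃ a : K, 0 < D Q → x ∈ Q.ring → Q ∈ placesOver x a := fun Q => by
    by_cases h : 0 < D Q ∧ x ∈ Q.ring
    · obtain ⟨a, ha⟩ := exists_mem_placesOver (hdeg Q h.1) h.2
      exact ⟨a, fun _ _ => ha⟩
    · exact ⟨0, fun h1 h2 => absurd ⟨h1, h2⟩ h⟩
  choose a ha using hsel
  let s : Finset (Place K H) := D.support.filter fun Q => 0 < D Q ∧ x ∈ Q.ring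
  have hs : ∀ Q, Q ∈ s ↔ 0 < D Q ∧ x ∈ Q.ring := fun Q => by
    simp only [s, Finset.mem_filter, Finsupp.mem_support_iff]
    exact ⟨fun h => h.2, fun h => ⟨h.1.ne', h⟩⟩
  have hPs : P ∈ s := (hs P).2 ⟨hDP, hx⟩
  have hPa : P ∈ placesOver x (a P) := ha P hDP hx
  have hl0 : clearingPolynomial D a s ≠ 0 := monic_clearingPolynomial.ne_zero
  obtain ⟨R, hR⟩ := hg.placesAtInfinity_nonempty
  have hRs : R ∉ s := fun h => hR ((hs R).1 h).2
  have hmem : ∀ Q : Place K H, x ∈ Q.ring →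
      f⁻¹ * aeval x (clearingPolynomial D a s) ∈ Q.ring := fun Q hQ =>
    inv_mul_clearingPolynomial_mem hf hQ (fun h => ha Q ((hs Q).1 h).1 hQ)
      fun h => (hs Q).2 ⟨h, hQ⟩
  -- Each affine zero costs a factor `x - a` of pole order `q`, while a zero at infinity counts only
  -- once; with at most two zeros the total is at most `2q`.
  have hbound : D R + q * (clearingPolynomial D a s).natDegree ≤ 2 * q := by
    have h1 := (D.sum_posPart_le (insert R s)).trans hD
    rw [Finset.sum_insert hRs] at h1
    have h2 : ((clearingPolynomial D a s).natDegree : ℤ) = ∑ P ∈ s, max (D P) 0 := by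
      rw [natDegree_clearingPolynomial, Nat.cast_sum]
      exact Finset.sum_congr rfl fun Q _ => Int.toNat_eq_max _
    rw [← h2] at h1
    have h3 : (clearingPolynomial D a s).natDegree ≤ 2 := by
      have := le_max_right (D R) 0
      omega
    have h4 := le_max_left (D R) 0
    have h5 := le_max_right (D R) 0
    interval_cases (clearingPolynomial D a s).natDegree <;> push_cast at * <;> omega
  obtain ⟨p, c, -, hpc⟩ := hg.exists_eq_aeval_add hmem hR (by
    rw [hg.valuation_inv_mul_aeval hf hl0 hR]
    exact (R.strictAnti_zpow_valuation hg.div_ne_zero (hg.valuation_div_lt_one hR)).antitone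
      (by linarith))
  obtain ⟨roots, hcard, hroots⟩ := hg.exists_roots (a P)
  have hpt : ∀ b : K, ∃ Q : Place K H, b ∈ roots → Q ∈ placesOver x (a P) ∩ placesOver y b :=
    fun b => by
      by_cases hb : b ∈ roots
      · obtain ⟨Q, hQ⟩ := hg.placesOver_inter_nonempty (hroots b hb)
        exact ⟨Q, fun _ => hQ⟩
      · exact ⟨P, fun h => absurd h hb⟩
  choose Q hQ using hpt
  have hQinj : Set.InjOn Q roots := fun b hb b' hb' h =>
    eq_of_mem_placesOver (hQ b hb).2 (h ▸ (hQ b' hb').2)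
  -- At a point of the fibre other than `P`, the factors for the other zeros already make the
  -- function regular, and the factor belonging to `P` vanishes there as well.
  have hvan : ∀ b ∈ roots, Q b ≠ P → p.eval (a P) + c * b = 0 := by
    intro b hb hne
    refine evalEval_eq_zero_of_valuation_lt_one (hQ b hb).1 (hQ b hb).2 ?_
    have hxQ := mem_ring_of_mem_placesOver (hQ b hb).1
    rw [← hpc, clearingPolynomial_eq_mul_erase hPs, map_mul (aeval x), mul_left_comm, map_mul, map_pow,
      map_pow, map_sub, aeval_X, aeval_C]
    refine lt_of_le_of_lt (mul_le_of_le_one_right' ?_) (pow_lt_one₀ zero_le (hQ b hb).1 (by omega))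
    rw [ValuationSubring.valuation_le_one_iff]
    exact inv_mul_clearingPolynomial_mem hf hxQ
      (fun h => ha _ ((hs _).1 (Finset.mem_of_mem_erase h)).1 hxQ)
      fun h => Finset.mem_erase.2 ⟨hne, (hs _).2 ⟨h, hxQ⟩⟩
  -- At most one of three points of the fibre is `P`, so two distinct values of `b` remain.
  have hc : c = 0 := by
    obtain ⟨b₁, h1, b₂, h2, b₃, h3, h12, h13, h23⟩ := Finset.two_lt_card.1 hcard
    by_cases hb1 : Q b₁ = P
    · exact eq_zero_of_eval_add_mul_eq_zero h23
        (hvan _ h2 fun h => h12 (hQinj h1 h2 (hb1.trans h.symm)))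
        (hvan _ h3 fun h => h13 (hQinj h1 h3 (hb1.trans h.symm)))
    by_cases hb2 : Q b₂ = P
    · exact eq_zero_of_eval_add_mul_eq_zero h13 (hvan _ h1 hb1)
        (hvan _ h3 fun h => h23 (hQinj h2 h3 (hb2.trans h.symm)))
    · exact eq_zero_of_eval_add_mul_eq_zero h12 (hvan _ h1 hb1) (hvan _ h2 hb2)
  rw [hc, _root_.map_zero, zero_mul, add_zero] at hpc
  -- Now `f⁻¹` is a quotient of polynomials in `x`, so its pole at `P` occurs on the whole fibre.
  have hpole : ∀ b ∈ roots, 0 < D (Q b) := by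
    intro b hb
    have h1 : 1 < P.ring.valuation f⁻¹ := by
      rw [(hf.2 P).inv.one_lt_valuation_iff]
      omega
    have h2 := hg.one_lt_valuation_of_mul_aeval_eq (inv_ne_zero hf.1) hl0 hpc hPa (hQ b hb).1 h1
    rw [(hf.2 _).inv.one_lt_valuation_iff] at h2
    omega
  have h1 := (D.sum_posPart_le (roots.image Q)).trans hD
  rw [Finset.sum_image hQinj] at h1
  have h2 : ∑ b ∈ roots, (1 : ℤ) ≤ ∑ b ∈ roots, max (D (Q b)) 0 :=
    Finset.sum_le_sum fun b hb => le_max_of_le_left (hpole b hb)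
  rw [Finset.sum_const, nsmul_one] at h2
  omega

/-- A function with at most two zeros, all rational, is constant. -/
theorem mem_range_of_sum_posPart_le {f : H} {D : Divisor K H} (hf : D.IsDivisorOf f)
    (hdeg : ∀ P, 0 < D P → P.degree = 1) (hD : ∑ P ∈ D.support, max (D P) 0 ≤ 2) :
    f ∈ Set.range (algebraMap K H) := by
  obtain ⟨R, hR⟩ := hg.placesAtInfinity_nonempty
  have hDR : D R ≤ 2 := by
    have := (D.sum_posPart_le {R}).trans hD
    rw [Finset.sum_singleton] at this
    exact (le_max_left _ _).trans this
  obtain ⟨c, hc⟩ := hg.mem_range_algebraMap (z := f⁻¹) (fun P hx => by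
    rw [← P.ring.valuation_le_one_iff, ← not_lt, (hf.2 P).inv.one_lt_valuation_iff]
    have := hg.not_pos_of_sum_posPart_le hf hdeg hD hx
    omega) hR (by
    rw [(hg.isOrd_iff hR).1 (hf.2 R).inv]
    exact (R.strictAnti_zpow_valuation hg.div_ne_zero (hg.valuation_div_lt_one hR)).antitone
      (by omega))
  exact ⟨c⁻¹, by rw [map_inv₀, hc, inv_inv]⟩

end HermitianGenerators

/-! ### Automorphisms acting trivially -/

namespace FunctionFieldDivisor

theorem Divisor.IsDivisorOf.eq_zero_of_mem_range {K F : Type*} [Field K] [Field F] [Algebra K F]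
    {f : F} {D : Divisor K F} (hf : D.IsDivisorOf f) (h : f ∈ Set.range (algebraMap K F)) :
    D = 0 := by
  obtain ⟨c, rfl⟩ := h
  ext P
  have hc : c ≠ 0 := by
    rintro rfl
    exact hf.1 (map_zero _)
  obtain ⟨t, ht, h⟩ := hf.2 P
  exact (hf.2 P).unique (n := 0) ⟨t, ht, by rw [zpow_zero, P.valuation_algebraMap hc]⟩

theorem Divisor.degree_single {K F : Type*} [Field K] [Field F] [Algebra K F] (P : Place K F)
    (n : ℤ) : Divisor.degree (Finsupp.single P n) = n * P.degree := by
  simp [Divisor.degree]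

theorem Divisor.map_single {K F : Type*} [Field K] [Field F] [Algebra K F] (σ : F ≃ₐ[K] F)
    (P : Place K F) (n : ℤ) :
    Divisor.map σ (Finsupp.single P n) = Finsupp.single (P.map σ) n :=
  Finsupp.mapDomain_single

end FunctionFieldDivisor

namespace HermitianGenerators

variable {q : ℕ} {K H : Type*} [Field K] [Field H] [Algebra K H] {x y : H}
  (hg : HermitianGenerators q K x y)

include hg

/-- Here `z = p(x) + c * y` with `p` of degree at most two. Two points over `x = 0` give `c = 0`,
and then `p` vanishes on all of `K`. -/
theorem eq_zero_of_vanishing {z : H} (hz : ∀ P : Place K H, x ∈ P.ring → z ∈ P.ring)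
    {R : Place K H} (hR : R ∈ placesAtInfinity K x)
    (hv : R.ring.valuation z ≤ R.ring.valuation (x / y) ^ (-(2 * q) : ℤ))
    (h0 : ∀ a b : K, b ^ q + b = a ^ (q + 1) → ∀ P ∈ placesOver x a ∩ placesOver y b,
      P.ring.valuation z < 1) : z = 0 := by
  obtain ⟨p, c, hp, rfl⟩ := hg.exists_eq_aeval_add hz hR hv
  have hvan : ∀ a b : K, b ^ q + b = a ^ (q + 1) → p.eval a + c * b = 0 := by
    intro a b hab
    obtain ⟨P, hP⟩ := hg.placesOver_inter_nonempty hab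
    exact evalEval_eq_zero_of_valuation_lt_one hP.1 hP.2 (h0 a b hab P hP)
  have hroots : ∀ a : K, ∃ b, b ^ q + b = a ^ (q + 1) := fun a => by
    obtain ⟨s, hs, hs'⟩ := hg.exists_roots a
    obtain ⟨b, hb⟩ := Finset.card_pos.1 (by omega : 0 < s.card)
    exact ⟨b, hs' b hb⟩
  obtain ⟨s, hs, hs'⟩ := hg.exists_roots 0
  have hc : c = 0 := by
    obtain ⟨b, hb, b', hb', hne⟩ := Finset.one_lt_card.1 (by omega : 1 < s.card)
    exact eq_zero_of_eval_add_mul_eq_zero hne (hvan _ _ (hs' _ hb)) (hvan _ _ (hs' _ hb'))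
  subst hc
  have hp0 : p = 0 := by
    -- The set `s` is reused merely as more than two elements of `K`, now as values of `x`.
    refine eq_zero_of_natDegree_lt_card_of_eval_eq_zero' p s (fun a _ => ?_) (by omega)
    obtain ⟨b, hb⟩ := hroots a
    simpa using hvan a b hb
  simp [hp0]

/-- An automorphism that fixes all rational places is trivial. -/
theorem eq_one_of_map_eq {σ : H ≃ₐ[K] H} (hσ : ∀ P : Place K H, P.degree = 1 → P.map σ = P) :
    σ = 1 := by
  have hq := hg.two_lt
  obtain ⟨R, hR⟩ := hg.placesAtInfinity_nonempty
  have hRσ := hσ R (hg.degree_eq_one_of_mem_placesAtInfinity hR)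
  -- Since `σ` fixes the only pole of `x`, it permutes the places where `x` is regular.
  have haff : ∀ P : Place K H, x ∈ P.ring → ∃ Q : Place K H, x ∈ Q.ring ∧ P = Q.map σ := by
    intro P hP
    have e : P = (P.map σ⁻¹).map σ := by rw [← Place.map_mul, mul_inv_cancel, Place.map_one]
    refine ⟨P.map σ⁻¹, ?_, e⟩
    by_contra h
    rw [hg.placesAtInfinity_subsingleton h hR, hRσ] at e
    exact hR (e ▸ hP)
  have hmem : ∀ z : H, (∀ P : Place K H, x ∈ P.ring → z ∈ P.ring) →
      ∀ P : Place K H, x ∈ P.ring → σ z - z ∈ P.ring := by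
    intro z hz P hP
    obtain ⟨Q, hQ, e⟩ := haff P hP
    refine sub_mem ?_ (hz P hP)
    rw [e, Place.mem_ring_map]
    exact hz Q hQ
  have hval : ∀ (z : H) (n : ℤ), R.IsOrd z n → -(2 * q) ≤ n →
      R.ring.valuation (σ z - z) ≤ R.ring.valuation (x / y) ^ (-(2 * q) : ℤ) := by
    intro z n hz hn
    have hz' := hz.map σ
    rw [hRσ] at hz'
    have hle := (R.strictAnti_zpow_valuation hg.div_ne_zero
      (hg.valuation_div_lt_one hR)).antitone hn
    refine Valuation.map_sub_le _ ?_ ?_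
    · rw [(hg.isOrd_iff hR).1 hz']
      exact hle
    · rw [(hg.isOrd_iff hR).1 hz]
      exact hle
  have hvan : ∀ (z : H) (c : K) (P : Place K H), P.degree = 1 → P ∈ placesOver z c →
      P.ring.valuation (σ z - z) < 1 := by
    intro z c P hdeg hP
    have h1 : P.ring.valuation (σ (z - algebraMap K H c)) < 1 :=
      hσ P hdeg ▸ Place.valuation_map_lt_one_iff.2 hP
    have h2 := Valuation.map_sub_lt _ h1 hP
    rwa [_root_.map_sub σ, σ.commutes, sub_sub_sub_cancel_right] at h2
  have hx : σ x = x := sub_eq_zero.1 <| hg.eq_zero_of_vanishing (hmem x fun _ h => h) hR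
    (hval x (-q) ((hg.isOrd_iff hR).2 (hg.hasLeadingTerm_x.valuation_eq hR)) (by omega))
    fun a b hab P hP => hvan x a P (hg.degree_eq_one_of_mem_point hab hP) hP.1
  have hy : σ y = y := sub_eq_zero.1 <| hg.eq_zero_of_vanishing (hmem y fun _ h => hg.y_mem h) hR
    (hval y (-(q + 1)) ((hg.isOrd_iff hR).2 (hg.hasLeadingTerm_y.valuation_eq hR)) (by omega))
    fun a b hab P hP => hvan y b P (hg.degree_eq_one_of_mem_point hab hP) hP.2
  ext z
  have hz : z ∈ IntermediateField.adjoin K {x, y} := hg.adjoin_eq_top ▸ IntermediateField.mem_top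
  induction hz using IntermediateField.adjoin_induction with
  | mem z hz =>
    rcases hz with rfl | rfl
    · exact hx
    · exact hy
  | algebraMap c => exact σ.commutes c
  | add a b _ _ ha hb => rw [map_add, ha, hb, map_add]
  | inv a _ ha => rw [map_inv₀, ha, map_inv₀]
  | mul a b _ _ ha hb => rw [map_mul, ha, hb, map_mul]

/-- An automorphism that acts trivially on divisor classes fixes all rational places. -/
theorem map_eq_of_forall_class {σ : H ≃ₐ[K] H}
    (hσ : ∀ D : Div0 K H, Cl0.mk (Div0.map σ D) = Cl0.mk D) {P Q : Place K H}
    (hP : P.degree = 1) (hQ : Q.degree = 1) (hPQ : P ≠ Q) : P.map σ = P := by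
  classical
  let D : Div0 K H := ⟨Finsupp.single P 1 - Finsupp.single Q 1, AddMonoidHom.mem_ker.2 <| by
    rw [_root_.map_sub, Divisor.degree_single, Divisor.degree_single, hP, hQ, sub_self]⟩
  have h1 : Divisor.map σ (Finsupp.single P 1 - Finsupp.single Q 1) -
      (Finsupp.single P 1 - Finsupp.single Q 1) ∈ Princ K H :=
    (QuotientAddGroup.eq_iff_sub_mem (N := (Princ K H).addSubgroupOf (Div0 K H))).1 (hσ D)
  rw [_root_.map_sub, Divisor.map_single, Divisor.map_single] at h1
  have hE : Finsupp.single (P.map σ) 1 - Finsupp.single (Q.map σ) 1 -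
      (Finsupp.single P 1 - Finsupp.single Q 1) = (0 : Divisor K H) := by
    rcases eq_zero_or_exists_isDivisorOf_of_mem_princ h1 with h | ⟨f, hf⟩
    · exact h
    refine hf.eq_zero_of_mem_range (hg.mem_range_of_sum_posPart_le hf ?_ ?_)
    · intro S hS
      by_cases hS1 : S = P.map σ
      · rw [hS1, Place.degree_map, hP]
      by_cases hS2 : S = Q
      · rw [hS2, hQ]
      simp only [Finsupp.sub_apply, Finsupp.single_apply, Ne.symm hS1, Ne.symm hS2, if_false] at hS
      split_ifs at hS <;> omega
    · refine (Finset.sum_le_sum (g := fun S => (Finsupp.single (P.map σ) 1 : Divisor K H) S +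
        (Finsupp.single Q 1 : Divisor K H) S) fun S _ => ?_).trans ?_
      · simp only [Finsupp.sub_apply, Finsupp.single_apply]
        split_ifs <;> omega
      · rw [Finset.sum_add_distrib]
        have h3 : ∀ (S : Place K H) (s : Finset (Place K H)),
            ∑ T ∈ s, (Finsupp.single S 1 : Divisor K H) T ≤ 1 := fun S s => by
          simp only [Finsupp.single_apply, Finset.sum_ite_eq]
          split_ifs <;> omega
        exact add_le_add (h3 _ _) (h3 _ _)
  -- At `P` the term `-P` can only be cancelled by `σP`: the term `-σQ` has the same sign, and `Q ≠
  -- P`.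
  have h4 := DFunLike.congr_fun hE P
  simp only [Finsupp.sub_apply, Finsupp.single_apply, Finsupp.zero_apply, hPQ.symm] at h4
  by_contra hne
  simp only [hne, if_true, if_false] at h4
  split_ifs at h4 <;> omega

end HermitianGenerators

/-! ### Points over the finite field, and the theorem -/

/-- Over the field with `q ^ 2` elements, the equation `b ^ q + b = a ^ (q + 1)` has more than two
solutions `b` for every `a`. -/
theorem exists_roots_of_card_eq {K : Type*} [Field K] {q : ℕ} (hq : 2 < q)
    (hK : Nat.card K = q ^ 2) (hadd : ∀ f g : K[X], (f + g) ^ q = f ^ q + g ^ q)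
    (hq0 : (q : K) = 0) (a : K) :
    ∃ s : Finset K, 2 < s.card ∧ ∀ b ∈ s, b ^ q + b = a ^ (q + 1) := by
  classical
  have : Finite K := Nat.finite_of_card_ne_zero (by rw [hK]; positivity)
  have := Fintype.ofFinite K
  rw [Nat.card_eq_fintype_card] at hK
  let f : K[X] := X ^ q + (X - C (a ^ (q + 1)))
  have hdeg : f.natDegree = q := by
    rw [natDegree_add_eq_left_of_natDegree_lt, natDegree_X_pow]
    rw [natDegree_X_pow, natDegree_X_sub_C]
    omega
  have hf0 : f ≠ 0 := fun h => by
    rw [h, natDegree_zero] at hdeg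
    omega
  have hneg : (-1 : K[X]) ^ q = -1 := by
    have h := hadd 1 (-1)
    rw [add_neg_cancel, zero_pow (by omega), one_pow] at h
    linear_combination -h
  have ha : (a ^ (q + 1)) ^ q = a ^ (q + 1) := by
    have h : a ^ q ^ 2 = a := by rw [← hK, FiniteField.pow_card]
    calc (a ^ (q + 1)) ^ q = a ^ q ^ 2 * a ^ q := by ring
      _ = a ^ (q + 1) := by rw [h]; ring
  -- The norm `a ^ (q + 1)` is fixed by the `q`-th power map, so `f ^ q - f` collapses to `X ^ (q ^
  -- 2) - X`; thus `f` divides a polynomial that splits over `K`.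
  have hfq : f ^ q - f = X ^ Fintype.card K - X := by
    have h1 : f ^ q = X ^ q ^ 2 + (X ^ q - C (a ^ (q + 1))) := by
      have : f = X ^ q + (X + (-1) * C (a ^ (q + 1))) := by simp only [f]; ring
      rw [this, hadd, hadd, mul_pow, hneg, ← C_pow (n := q), ha]
      ring
    rw [h1, hK]
    simp only [f]
    ring
  have hdvd : f ∣ X ^ Fintype.card K - X := by
    rw [← hfq]
    exact dvd_sub (dvd_pow_self f (by omega)) dvd_rfl
  have hsplit : f.Splits := by
    refine Splits.of_dvd ?_ (FiniteField.X_pow_card_sub_X_ne_zero K Fintype.one_lt_card) hdvd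
    rw [splits_iff_card_roots, FiniteField.roots_X_pow_card_sub_X, ← Finset.card_def,
      Finset.card_univ, FiniteField.X_pow_card_sub_X_natDegree_eq K Fintype.one_lt_card]
  have hsep : f.Separable := by
    have hder : derivative f = 1 := by
      rw [derivative_add, derivative_X_sub_C, derivative_X_pow, hq0, C_0, zero_mul, zero_add]
    exact ⟨0, 1, by rw [hder]; simp⟩
  refine ⟨f.roots.toFinset, ?_, fun b hb => ?_⟩
  · rw [Multiset.toFinset_card_of_nodup (nodup_roots hsep), ← hsplit.natDegree_eq_card_roots, hdeg]
    exact hq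
  · rw [Multiset.mem_toFinset, mem_roots hf0, IsRoot.def] at hb
    simp only [f, eval_add, eval_sub, eval_pow, eval_X, eval_C] at hb
    linear_combination hb

theorem exists_hermitianGenerators {K H : Type*} [Field K] [Field H] [Algebra K H] {q : ℕ}
    (hq : 2 < q) (hK : Nat.card K = q ^ 2) (hH : IsHermitianFunctionField q K H) :
    ∃ x y : H, HermitianGenerators q K x y := by
  obtain ⟨x, y, hx, hxy, htop⟩ := hH
  have : Finite K := Nat.finite_of_card_ne_zero (by rw [hK]; positivity)
  have := Fintype.ofFinite K
  obtain ⟨p, hchar⟩ := CharP.exists K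
  obtain ⟨n, hp, hn⟩ := FiniteField.card K p
  rw [← Nat.card_eq_fintype_card, hK] at hn
  -- As a divisor of the prime power `q ^ 2`, `q` is itself a power of the characteristic.
  obtain ⟨m, -, hm⟩ := (Nat.dvd_prime_pow hp).1 (hn ▸ dvd_pow_self q two_ne_zero)
  have := Fact.mk hp
  have : CharP H p := charP_of_injective_algebraMap (algebraMap K H).injective p
  have hq0 : (q : K) = 0 := by
    rw [CharP.cast_eq_zero_iff K p, hm]
    refine dvd_pow_self p ?_
    rintro rfl
    rw [pow_zero] at hm
    omega
  refine ⟨x, y, hq, hq0, hx, hxy, htop, fun a b => ?_, exists_roots_of_card_eq hq hK (fun f g => ?_) hq0⟩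
  · rw [hm, sub_pow_char_pow]
  · rw [hm, add_pow_char_pow]

open FunctionFieldDivisor in
theorem mainTheorem6 {K H : Type*} [Field K] [Field H] [Algebra K H] (q : ℕ) (hq : 2 < q)
    (hK : Nat.card K = q ^ 2) (hH : IsHermitianFunctionField q K H) :
    (∃ φ : (H ≃ₐ[K] H) →* Multiplicative (AddAut (Cl0 K H)),
      (∀ (σ : H ≃ₐ[K] H) (D : Div0 K H),
        (φ σ).toAdd (Cl0.mk D) = Cl0.mk (Div0.map σ D)) ∧
      Function.Injective φ) ∧
    ∀ (f : H) (D : Divisor K H), D.IsDivisorOf f → (∀ P ∈ D.support, P.degree = 1) →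
      f ∉ Set.range (algebraMap K H) → 2 < ∑ P ∈ D.support, max (D P) 0 := by
  obtain ⟨x, y, hg⟩ := exists_hermitianGenerators hq hK hH
  refine ⟨⟨Cl0.autHom K H, Cl0.autHom_apply_mk, ?_⟩, ?_⟩
  · rw [injective_iff_map_eq_one]
    intro σ hσ
    have htriv : ∀ D : Div0 K H, Cl0.mk (Div0.map σ D) = Cl0.mk D := fun D => by
      rw [← Cl0.autHom_apply_mk, hσ]
      rfl
    -- Each rational place needs a different rational partner: `R` at infinity, or a point `Q` over
    -- `x = 0` when the place is `R` itself.
    obtain ⟨R, hR⟩ := hg.placesAtInfinity_nonempty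
    obtain ⟨s, hs, hs'⟩ := hg.exists_roots 0
    obtain ⟨b, hb⟩ := Finset.card_pos.1 (by omega : 0 < s.card)
    obtain ⟨Q, hQ⟩ := hg.placesOver_inter_nonempty (hs' b hb)
    have hQ1 := hg.degree_eq_one_of_mem_point (hs' b hb) hQ
    have hR1 := hg.degree_eq_one_of_mem_placesAtInfinity hR
    refine hg.eq_one_of_map_eq fun P hP => ?_
    by_cases hPR : P = R
    · refine hg.map_eq_of_forall_class htriv hP hQ1 fun h => hR ?_
      rw [← hPR, h]
      exact mem_ring_of_mem_placesOver hQ.1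
    · exact hg.map_eq_of_forall_class htriv hP hR1 hPR
  · intro f D hf hdeg hfK
    by_contra! h
    exact hfK (hg.mem_range_of_sum_posPart_le hf
      (fun P hP => hdeg P (Finsupp.mem_support_iff.2 hP.ne')) h)
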